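/- Let $X=(X_n)_{n\in\mathbb N}$ be independent random variables on a probability space $(\Omega,\mathcal F,P)$ with $P(X_n=1)=P(X_n=-1)=\tfrac12$. For $n\ge 0$ let $\Delta_n\subset\mathbb N^n$ be the set of $n$-tuples with pairwise distinct entries, and let $\|\cdot\|$ denote the $\ell^2$-norm of a real function on $\mathbb N^n$. Let $\ell^2_0(\mathbb N)^{\circ q}$ be the set of all $f:\mathbb N^q\to\mathbb R$ that are symmetric, square-summable and vanish outside $\Delta_q$. For such $f$ and $0\le l\le r\le q$ let $f\star_r^l f:\mathbb N^{2q-r-l}\to\mathbb R$ be the contraction $$(f\star_r^l f)(i_1,\dots,i_{q-r},j_1,\dots,j_{r-l},k_1,\dots,k_{q-r})=\sum_{(a_1,\dots,a_l)\in\Delta_l}f(i_1,\dots,i_{q-r},j_1,\dots,j_{r-l},a_1,\dots,a_l)\,f(k_1,\dots,k_{q-r},j_1,\dots,j_{r-l},a_1,\dots,a_l),$$ and let $$J_q(f)=q!\sum_{i_1<\dots<i_q}f(i_1,\dots,i_q)\,X_{i_1}\cdots X_{i_q}$$ be the discrete multiple stochastic integral of order $q$, the series converging in $L^2(P)$. For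 real random variables $Z,Z'$ put $d_K(Z,Z')=\sup_{x\in\mathbb R}|P(Z\le x)-P(Z'\le x)|$. **Theorem.** For every integer $q\ge 2$ there are constants $0<C_1,C_2<\infty$, depending only on $q$, such that the following holds. Let $f\in\ell^2_0(\mathbb N)^{\circ q}$ satisfy $\|(f\star_r^r f)\mathbf 1_{\Delta_{2(q-r)}}\|<1$ for all $r=1,\dots,q-1$, let $F=J_q(f)$, and let $N$ be a standard Gaussian random variable. Then $$d_K(F,N)\le C_1\max\Big\{\big|1-q!\|f\|^2\big|,\ \max_{r=1,\dots,q-1}\|(f\star_r^r f)\mathbf 1_{\Delta_{2(q-r)}}\|,\ \max_{r=1,\dots,q}\|f\star_r^{r-1}f\|\Big\}$$ $$\le C_2\max\Big\{\big|1-q!\|f\|^2\big|,\ \max_{r=1,\dots,q-1}\|f\star_r^r f\|\Big\}.$$ -/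

import Mathlib

open MeasureTheory ProbabilityTheory
open scoped ENNReal Nat

noncomputable section

namespace Rademacher

/-- `X 0, X 1, …` are independent, each taking the values `-1` and `+1` with probability `1/2`. -/
structure IsRademacherSequence {Ω : Type*} [MeasurableSpace Ω] (P : Measure Ω)
    (X : ℕ → Ω → ℝ) : Prop where
  measurable : ∀ n, Measurable (X n)
  prob_neg_one : ∀ n, P {ω | X n ω = -1} = 1 / 2
  prob_one : ∀ n, P {ω | X n ω = 1} = 1 / 2
  indep : iIndepFun X P

/-- The set `Δ_n` of `n`-tuples with pairwise distinct entries. -/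
def offDiag (n : ℕ) : Set (Fin n → ℕ) :=
  {i | ∀ k l : Fin n, k ≠ l → i k ≠ i l}

/-- Symmetric square-summable functions on `ℕ^n` vanishing on diagonals: `ℓ²_0(ℕ)^{∘n}`. -/
structure IsKernel {n : ℕ} (f : (Fin n → ℕ) → ℝ) : Prop where
  summable_sq : Summable fun i => f i ^ 2
  symmetric : ∀ (σ : Equiv.Perm (Fin n)) (i : Fin n → ℕ), f (i ∘ σ) = f i
  vanish : ∀ i, i ∉ offDiag n → f i = 0

/-- The `ℓ²`-norm of a (square-summable) function. -/
def l2norm {ι : Type*} (g : ι → ℝ) : ℝ :=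
  √(∑' i, g i ^ 2)

/-- The `n`-tuple `(i_1, …, i_{n-r}, j_1, …, j_{r-l}, a_1, …, a_l)`, for `l ≤ r ≤ n`. -/
def glue {n r l : ℕ} (i : Fin (n - r) → ℕ) (j : Fin (r - l) → ℕ) (a : Fin l → ℕ) :
    Fin n → ℕ := fun k =>
  if h₁ : (k : ℕ) < n - r then i ⟨k, h₁⟩
  else if h₂ : (k : ℕ) < n - l then j ⟨k - (n - r), by omega⟩
  else a ⟨k - (n - l), by omega⟩

/-- The contraction `f ⋆_r^l g`, for `l ≤ r ≤ min n m`, as a function of the tuple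
`(i_1, …, i_{n-r}, j_1, …, j_{r-l}, k_1, …, k_{m-r})`. -/
def contraction {n m : ℕ} (r l : ℕ) (f : (Fin n → ℕ) → ℝ) (g : (Fin m → ℕ) → ℝ) :
    (Fin ((n - r) + (r - l) + (m - r)) → ℕ) → ℝ := fun x =>
  let i : Fin (n - r) → ℕ := fun s => x (Fin.castAdd (m - r) (Fin.castAdd (r - l) s))
  let j : Fin (r - l) → ℕ := fun s => x (Fin.castAdd (m - r) (Fin.natAdd (n - r) s))
  let k : Fin (m - r) → ℕ := fun s => x (Fin.natAdd ((n - r) + (r - l)) s)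
  ∑' a : offDiag l, f (glue (r := r) (l := l) i j a) * g (glue (r := r) (l := l) k j a)

theorem glue_injective {n r l : ℕ} (hl : l ≤ r) (hr : r ≤ n) :
    Function.Injective fun p : ((Fin (n - r) → ℕ) × (Fin (r - l) → ℕ)) × (Fin l → ℕ) =>
      (glue p.1.1 p.1.2 p.2 : Fin n → ℕ) := by
  rintro ⟨⟨i, j⟩, a⟩ ⟨⟨i', j'⟩, a'⟩ h
  have h' := fun k => congrFun h k
  simp only [glue] at h'
  refine Prod.ext (Prod.ext ?_ ?_) ?_ <;> funext s
  · have := h' ⟨s, by omega⟩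
    simpa using this
  · have := h' ⟨n - r + s, by omega⟩
    have h₂ : n - r + (s : ℕ) < n - l := by omega
    simpa [h₂] using this
  · have := h' ⟨n - l + s, by omega⟩
    have h₁ : ¬ n - l + (s : ℕ) < n - r := by omega
    simpa [h₁] using this

/-- The contraction of square-summable functions is well-defined and square-summable. -/
theorem summable_contraction {n m r l : ℕ} (hl : l ≤ r) (hn : r ≤ n) (hm : r ≤ m)
    {f : (Fin n → ℕ) → ℝ} {g : (Fin m → ℕ) → ℝ}
    (hf : Summable fun i => f i ^ 2) (hg : Summable fun i => g i ^ 2) :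
    (∀ i j k, Summable fun a : offDiag l =>
        f (glue (r := r) (l := l) i j a) * g (glue (r := r) (l := l) k j a)) ∧
      Summable fun x => contraction r l f g x ^ 2 := by
  have key : ∀ {n : ℕ} {f : (Fin n → ℕ) → ℝ}, r ≤ n → (Summable fun i => f i ^ 2) →
      (∀ i j, Summable fun a : offDiag l => f (glue (r := r) (l := l) i j a) ^ 2) ∧
      Summable fun p : (Fin (n - r) → ℕ) × (Fin (r - l) → ℕ) =>
        ∑' a : offDiag l, f (glue (r := r) (l := l) p.1 p.2 a) ^ 2 := by
    intro n f hn hf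
    have h := hf.comp_injective (glue_injective hl hn)
    have h2 := h.comp_injective
      (i := fun p : ((Fin (n - r) → ℕ) × (Fin (r - l) → ℕ)) × offDiag l => (p.1, p.2.1))
      (fun p p' hp => by
        simp only [Prod.mk.injEq] at hp
        exact Prod.ext hp.1 (Subtype.ext hp.2))
    exact ⟨fun i j => h2.prod_factor (i, j), h2.prod⟩
  obtain ⟨hf1, hf2⟩ := key hn hf
  obtain ⟨hg1, hg2⟩ := key hm hg
  have hs : ∀ i j k,
      Summable fun a : offDiag l =>
        f (glue (r := r) (l := l) i j a) * g (glue (r := r) (l := l) k j a) := by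
    intro i j k
    refine Summable.of_norm_bounded ((hf1 i j).add (hg1 k j)) fun a => ?_
    rw [Real.norm_eq_abs, abs_le]
    constructor <;> nlinarith [sq_nonneg (f (glue (r := r) (l := l) i j a) + g (glue (r := r) (l := l) k j a)),
      sq_nonneg (f (glue (r := r) (l := l) i j a) - g (glue (r := r) (l := l) k j a)),
      sq_nonneg (f (glue (r := r) (l := l) i j a)), sq_nonneg (g (glue (r := r) (l := l) k j a))]
  refine ⟨hs, ?_⟩
  have hprod := hf2.mul_of_nonneg hg2 (fun p => tsum_nonneg fun a => sq_nonneg _)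
    (fun p => tsum_nonneg fun a => sq_nonneg _)
  have hinj : Function.Injective
      (fun x : Fin ((n - r) + (r - l) + (m - r)) → ℕ =>
        (((fun s => x (Fin.castAdd (m - r) (Fin.castAdd (r - l) s)) : Fin (n - r) → ℕ),
          (fun s => x (Fin.castAdd (m - r) (Fin.natAdd (n - r) s)) : Fin (r - l) → ℕ)),
         ((fun s => x (Fin.natAdd ((n - r) + (r - l)) s) : Fin (m - r) → ℕ),
          (fun s => x (Fin.castAdd (m - r) (Fin.natAdd (n - r) s)) : Fin (r - l) → ℕ)))) := by
    intro x y h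
    simp only [Prod.mk.injEq] at h
    obtain ⟨⟨h1, h2⟩, h3, -⟩ := h
    funext t
    refine Fin.addCases (fun t => ?_) (fun t => congrFun h3 t) t
    exact Fin.addCases (fun t => congrFun h1 t) (fun t => congrFun h2 t) t
  refine Summable.of_nonneg_of_le (fun x => sq_nonneg _) (fun x => ?_)
    (hprod.comp_injective hinj)
  simp only [contraction, Function.comp_apply]
  set i : Fin (n - r) → ℕ := fun s => x (Fin.castAdd (m - r) (Fin.castAdd (r - l) s))
  set j : Fin (r - l) → ℕ := fun s => x (Fin.castAdd (m - r) (Fin.natAdd (n - r) s))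
  set k : Fin (m - r) → ℕ := fun s => x (Fin.natAdd ((n - r) + (r - l)) s)
  have t₁ := (hs i j k).hasSum
  have t₂ := (hf1 i j).hasSum
  have t₃ := (hg1 k j).hasSum
  unfold HasSum at t₁ t₂ t₃
  refine le_of_tendsto_of_tendsto' (t₁.pow 2) (t₂.mul t₃) fun s => ?_
  exact Finset.sum_mul_sq_le_sq_mul_sq s _ _

/-- The norm `‖f ⋆_r^l f‖`. -/
def contrNorm {q : ℕ} (r l : ℕ) (f : (Fin q → ℕ) → ℝ) : ℝ :=
  l2norm (contraction r l f f)

/-- The norm `‖(f ⋆_r^r f) 1_Δ‖` with `Δ = Δ_{2(q-r)}`. -/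
def offDiagContrNorm {q : ℕ} (r : ℕ) (f : (Fin q → ℕ) → ℝ) : ℝ :=
  l2norm ((offDiag ((q - r) + (r - r) + (q - r))).indicator (contraction r r f f))

section MultipleIntegral

variable {Ω : Type*} [MeasurableSpace Ω] {P : Measure Ω} [IsProbabilityMeasure P]
  {X : ℕ → Ω → ℝ}

theorem IsRademacherSequence.ae_sq (hX : IsRademacherSequence P X) (n : ℕ) :
    ∀ᵐ ω ∂P, X n ω ^ 2 = 1 := by
  have hm1 : MeasurableSet {ω | X n ω = 1} := hX.measurable n (measurableSet_singleton 1)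
  have hd : Disjoint {ω | X n ω = -1} {ω | X n ω = 1} := by
    rw [Set.disjoint_left]
    intro ω h h'
    simp only [Set.mem_ofPred_eq] at h h'
    linarith
  have hu : P ({ω | X n ω = -1} ∪ {ω | X n ω = 1}) = 1 := by
    rw [measure_union hd hm1, hX.prob_neg_one, hX.prob_one, ENNReal.add_halves]
  have hmu : MeasurableSet ({ω | X n ω = -1} ∪ {ω | X n ω = 1}) :=
    (hX.measurable n (measurableSet_singleton (-1))).union hm1
  have hae := (prob_compl_eq_zero_iff hmu).2 hu
  rw [ae_iff]
  refine measure_mono_null ?_ hae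
  intro ω h h'
  rcases h' with h' | h' <;> simp only [Set.mem_ofPred_eq] at h h' <;> simp [h'] at h

theorem IsRademacherSequence.memLp_prod (hX : IsRademacherSequence P X) {q : ℕ}
    (i : Fin q → ℕ) : MemLp (fun ω => ∏ k, X (i k) ω) 2 P := by
  refine MemLp.of_bound (C := 1)
    (Finset.measurable_prod _ fun k _ => hX.measurable (i k)).aestronglyMeasurable ?_
  have : ∀ᵐ ω ∂P, ∀ n, X n ω ^ 2 = 1 := ae_all_iff.2 hX.ae_sq
  filter_upwards [this] with ω h
  rw [Real.norm_eq_abs, Finset.abs_prod]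
  refine (Finset.prod_eq_one fun k _ => ?_).le
  rw [← sq_eq_sq₀ (abs_nonneg _) zero_le_one, sq_abs, h, one_pow]

/-- The product `X_{i_1} ⋯ X_{i_q}` as an element of `L²(P)`. -/
def walsh (hX : IsRademacherSequence P X) {q : ℕ} (i : Fin q → ℕ) : Lp ℝ 2 P :=
  (hX.memLp_prod i).toLp (fun ω => ∏ k, X (i k) ω)

/-- The discrete multiple stochastic integral
`J_q(f) = q! ∑_{i_1 < ⋯ < i_q} f(i_1, …, i_q) X_{i_1} ⋯ X_{i_q}`,
the series being summed in `L²(P)`, where it converges unconditionally. -/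
def multipleIntegral (hX : IsRademacherSequence P X) {q : ℕ} (f : (Fin q → ℕ) → ℝ) :
    Lp ℝ 2 P :=
  (q ! : ℝ) • ∑' i : {i : Fin q → ℕ // StrictMono i}, f i • walsh hX i.1

theorem IsRademacherSequence.integral_eq_zero (hX : IsRademacherSequence P X) (n : ℕ) :
    ∫ ω, X n ω ∂P = 0 := by
  have hm1 : MeasurableSet {ω | X n ω = 1} := hX.measurable n (measurableSet_singleton 1)
  have hm2 : MeasurableSet {ω | X n ω = -1} := hX.measurable n (measurableSet_singleton (-1))
  have h : X n =ᵐ[P] fun ω => {ω | X n ω = 1}.indicator (fun _ => (1 : ℝ)) ω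
      - {ω | X n ω = -1}.indicator (fun _ => (1 : ℝ)) ω := by
    filter_upwards [hX.ae_sq n] with ω hω
    have h' : (X n ω - 1) * (X n ω + 1) = 0 := by linear_combination hω
    rcases mul_eq_zero.1 h' with h | h
    · have h : X n ω = 1 := by linarith
      simp [Set.indicator, h]
      norm_num
    · have h : X n ω = -1 := by linarith
      simp [Set.indicator, h]
      norm_num
  rw [integral_congr_ae h, integral_sub, integral_indicator hm1, integral_indicator hm2]
  · simp [measureReal_def, hX.prob_one, hX.prob_neg_one]
  · exact (integrable_const 1).indicator hm1
  · exact (integrable_const 1).indicator hm2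

theorem orthonormal_walsh (hX : IsRademacherSequence P X) (q : ℕ) :
    Orthonormal ℝ fun i : {i : Fin q → ℕ // StrictMono i} => walsh hX i.1 := by
  have hinner : ∀ i j : {i : Fin q → ℕ // StrictMono i},
      inner ℝ (walsh hX i.1) (walsh hX j.1)
        = ∫ ω, (∏ k, X (i.1 k) ω) * ∏ k, X (j.1 k) ω ∂P := by
    intro i j
    rw [L2.inner_def]
    refine integral_congr_ae ?_
    filter_upwards [(hX.memLp_prod i.1).coeFn_toLp, (hX.memLp_prod j.1).coeFn_toLp]
      with ω h₁ h₂
    simp only [walsh, h₁, h₂]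
    simp [mul_comm]
  classical
  rw [orthonormal_iff_ite]
  intro i j
  rw [hinner]
  split_ifs with hij
  · subst hij
    have : ∀ᵐ ω ∂P, ∀ n, X n ω ^ 2 = 1 := ae_all_iff.2 hX.ae_sq
    have h : (fun ω => (∏ k, X (i.1 k) ω) * ∏ k, X (i.1 k) ω) =ᵐ[P] fun _ => (1 : ℝ) := by
      filter_upwards [this] with ω h
      rw [← Finset.prod_mul_distrib]
      exact Finset.prod_eq_one fun k _ => by rw [← sq, h]
    rw [integral_congr_ae h]
    simp
  · have hr : Finset.univ.image i.1 ≠ Finset.univ.image j.1 := by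
      intro h
      apply hij
      apply Subtype.ext
      rw [← i.2.range_inj j.2]
      have := congrArg (fun s : Finset ℕ => (s : Set ℕ)) h
      simpa using this
    set S := Finset.univ.image i.1
    set T := Finset.univ.image j.1
    let e : ℕ → ℕ := fun n => (if n ∈ S then 1 else 0) + (if n ∈ T then 1 else 0)
    have hprod : ∀ ω, (∏ k, X (i.1 k) ω) * ∏ k, X (j.1 k) ω
        = ∏ n : ↥(S ∪ T), X n ω ^ e n := by
      intro ω
      have h1 : ∏ k, X (i.1 k) ω = ∏ n ∈ S ∪ T, X n ω ^ (if n ∈ S then 1 else 0) := by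
        rw [← Finset.prod_subset (Finset.subset_union_left (s₁ := S) (s₂ := T))
          (fun n _ hn => by simp [hn]),
          Finset.prod_image (fun a _ b _ h => i.2.injective h)]
        exact Finset.prod_congr rfl fun k _ => by simp [S]
      have h2 : ∏ k, X (j.1 k) ω = ∏ n ∈ S ∪ T, X n ω ^ (if n ∈ T then 1 else 0) := by
        rw [← Finset.prod_subset (Finset.subset_union_right (s₁ := S) (s₂ := T))
          (fun n _ hn => by simp [hn]),
          Finset.prod_image (fun a _ b _ h => j.2.injective h)]
        exact Finset.prod_congr rfl fun k _ => by simp [T]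
      rw [h1, h2, ← Finset.prod_mul_distrib, ← Finset.prod_coe_sort]
      exact Finset.prod_congr rfl fun n _ => by rw [← pow_add]
    simp_rw [hprod]
    have hind : iIndepFun (fun n : ↥(S ∪ T) => X n) P :=
      hX.indep.precomp Subtype.val_injective
    rw [hind.integral_fun_prod_comp (f := fun (n : ↥(S ∪ T)) (x : ℝ) => x ^ e n)
      (fun n => (hX.measurable n).aemeasurable)
      (fun n => (measurable_id.pow_const _).aestronglyMeasurable)]
    obtain ⟨n, hn⟩ : ∃ n, ¬(n ∈ S ↔ n ∈ T) := by
      by_contra! h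
      exact hr (Finset.ext h)
    have hnU : n ∈ S ∪ T := by
      rw [Finset.mem_union]
      tauto
    have hen : e n = 1 := by
      by_cases h1 : n ∈ S <;> by_cases h2 : n ∈ T <;> simp_all [e]
    refine Finset.prod_eq_zero (Finset.mem_univ (⟨n, hnU⟩ : ↥(S ∪ T))) ?_
    simp only [hen, pow_one]
    exact hX.integral_eq_zero n

/-- The series in the definition of `multipleIntegral` converges in `L²(P)`. -/
theorem summable_multipleIntegral (hX : IsRademacherSequence P X) {q : ℕ}
    {f : (Fin q → ℕ) → ℝ} (hf : Summable fun i => f i ^ 2) :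
    Summable fun i : {i : Fin q → ℕ // StrictMono i} => f i • walsh hX i.1 := by
  have h := (orthonormal_walsh hX q).orthogonalFamily.summable_iff_norm_sq_summable
    (f := fun i => f i)
  simp only [LinearIsometry.toSpanSingleton_apply] at h
  rw [h]
  simpa [Function.comp_def] using
    hf.comp_injective (Subtype.val_injective (p := fun i : Fin q → ℕ => StrictMono i))

end MultipleIntegral

/-- The Kolmogorov distance `sup_x |P(Z ≤ x) - Q(N ≤ x)|` of the random variable `Z` on
`(Ω, P)` and the random variable `N` on `(Ω', Q)`. -/
def kolmogorovDist {Ω Ω' : Type*} [MeasurableSpace Ω] [MeasurableSpace Ω']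
    (P : Measure Ω) (Z : Ω → ℝ) (Q : Measure Ω') (N : Ω' → ℝ) : ℝ :=
  ⨆ x : ℝ, |P.real {ω | Z ω ≤ x} - Q.real {ω | N ω ≤ x}|

/-- The maximum of `|1 - q! ‖f‖²|`, of `‖(f ⋆_r^r f) 1_Δ‖` over `1 ≤ r ≤ q - 1`, and of
`‖f ⋆_r^{r-1} f‖` over `1 ≤ r ≤ q`. -/
def firstBound {q : ℕ} (hq : 2 ≤ q) (f : (Fin q → ℕ) → ℝ) : ℝ :=
  max |1 - (q ! : ℝ) * l2norm f ^ 2|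
    (max
      ((Finset.Icc 1 (q - 1)).sup' (Finset.nonempty_Icc.2 (by omega))
        fun r => offDiagContrNorm r f)
      ((Finset.Icc 1 q).sup' (Finset.nonempty_Icc.2 (by omega))
        fun r => contrNorm r (r - 1) f))

/-- The maximum of `|1 - q! ‖f‖²|` and of `‖f ⋆_r^r f‖` over `1 ≤ r ≤ q - 1`. -/
def secondBound {q : ℕ} (hq : 2 ≤ q) (f : (Fin q → ℕ) → ℝ) : ℝ :=
  max |1 - (q ! : ℝ) * l2norm f ^ 2|
    ((Finset.Icc 1 (q - 1)).sup' (Finset.nonempty_Icc.2 (by omega))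
      fun r => contrNorm r r f)

end Rademacher

end

/-!
The first inequality is proved by Stein's method on the discrete cube, and the second one by
comparing contraction norms.

Let `F` be a homogeneous polynomial of degree `q` in finitely many independent random signs `x_k`,
let `∂_k` be the discrete derivative and `S = (1 / q) ∑_k (∂_k F)²`. As `F` is an eigenfunction of
the number operator, `𝔼 F g(F) = (1 / q) ∑_k 𝔼 (∂_k F) (∂_k g(F))`. For `g` the solution of Stein's
equation `g'(w) - w g(w) = 1_{w ≤ y} - Φ(y)` this bounds `P(F ≤ y) - Φ(y)` by three terms:
`2 𝔼 |1 - S|`, a sum of cubes `𝔼 (1 + |F|) ∑_k |∂_k F|³`, and a term due to the jump of `g'` at `y`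
(`abs_steinSolution_taylor_le`, `abs_stein_remainder_le`). Up to a constant factor the last one is
the mean of the divergence `∑_k x_k |∂_k F| ∂_k F` against `1_{F ≤ y}`, and so it is bounded by the
`L²`-norm of this divergence (`avg_divergence_sq_le`). By hypercontractivity, in the form of the
Bonami lemma `avg_poly_pow_four_le`, the last two terms are at most of order
`(∑_k (𝔼 (∂_k F)²)²)^{1/2}`, which is a multiple of `‖f ⋆_q^{q-1} f‖`. This gives
`abs_avg_indicator_sub_le`.

For the first term, `S` has mean `q! ‖f‖²`. Its Walsh coefficient at a set `T ≠ ∅` is a combination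
of sums `∑_R c(I ∪ R) c(J ∪ R)` over the splittings `T = I ⊔ J` into two parts of equal size
(`gradSqCoeff_eq`), and these sums are multiples of values of `f ⋆_r^r f`, with `r = q - |I|`, at
tuples of distinct entries (`contraction_eq`). So the standard deviation of `S` is bounded by the
norms of `(f ⋆_r^r f) 1_Δ`, `1 ≤ r ≤ q - 1` (`avg_one_sub_carre_sq_le`,
`sum_setContraction_sq_le`).

A general kernel is approximated by its truncations: the contraction norms converge by dominated
convergence, and the partial sums of `J_q(f)` converge in `L²`, hence in measure, which preserves
uniform bounds on the distance to the continuous function `Φ`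
(`abs_measureReal_sub_le_of_tendstoInMeasure`).

For the second inequality, `f ⋆_{r+1}^r f` is a restriction of `f ⋆_r^r f` to a diagonal
(`contrNorm_succ_le`), and `f ⋆_1^0 f` has the same norm as `f ⋆_q^{q-1} f`
(`contrNorm_one_zero_le`).
-/

namespace Rademacher

/-! ### Stein's equation for half-lines -/

section SteinSolution

open Set

/-- The standard normal density. -/
local notation "gpdf" => gaussianPDFReal 0 1

/-- The distribution function of the standard normal law. -/
noncomputable def normalCDF (x : ℝ) : ℝ := (gaussianReal 0 1).real (Iic x)

theorem normalCDF_eq_integral (x : ℝ) : normalCDF x = ∫ t in Iic x, gpdf t := by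
  rw [normalCDF, measureReal_def, gaussianReal_apply_eq_integral _ one_ne_zero,
    ENNReal.toReal_ofReal]
  exact integral_nonneg fun t => gaussianPDFReal_nonneg _ _ _

theorem one_sub_normalCDF_eq_integral (x : ℝ) : 1 - normalCDF x = ∫ t in Ioi x, gpdf t := by
  rw [normalCDF_eq_integral, ← integral_gaussianPDFReal_eq_one 0 (one_ne_zero),
    ← intervalIntegral.integral_Iic_add_Ioi (b := x) (integrable_gaussianPDFReal 0 1).integrableOn
      (integrable_gaussianPDFReal 0 1).integrableOn]
  ring

theorem normalCDF_nonneg (x : ℝ) : 0 ≤ normalCDF x := measureReal_nonneg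

theorem normalCDF_le_one (x : ℝ) : normalCDF x ≤ 1 := measureReal_le_one

theorem normalCDF_mono : Monotone normalCDF := fun _ _ h =>
  measureReal_mono (Iic_subset_Iic.2 h)

theorem gpdf_eq (t : ℝ) : gpdf t = (√(2 * Real.pi))⁻¹ * Real.exp (-t ^ 2 / 2) := by
  simp [gaussianPDFReal]

theorem hasDerivAt_gpdf (t : ℝ) : HasDerivAt gpdf (-(t * gpdf t)) t := by
  have h : gpdf = fun t => (√(2 * Real.pi))⁻¹ * Real.exp (-t ^ 2 / 2) := funext gpdf_eq
  rw [h]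
  have := ((((hasDerivAt_id t).pow 2).neg.div_const 2).exp).const_mul ((√(2 * Real.pi))⁻¹)
  refine this.congr_deriv ?_
  simp
  ring

theorem gpdf_pos (t : ℝ) : 0 < gpdf t := gaussianPDFReal_pos _ _ _ one_ne_zero

theorem continuous_gpdf : Continuous gpdf :=
  continuous_iff_continuousAt.2 fun t => (hasDerivAt_gpdf t).continuousAt

theorem hasDerivAt_normalCDF (x : ℝ) : HasDerivAt normalCDF (gpdf x) x := by
  have h : normalCDF = fun x => normalCDF 0 + ∫ t in (0 : ℝ)..x, gpdf t := by
    funext x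
    rw [normalCDF_eq_integral, normalCDF_eq_integral, ← intervalIntegral.integral_Iic_sub_Iic
      (integrable_gaussianPDFReal 0 1).integrableOn (integrable_gaussianPDFReal 0 1).integrableOn]
    ring
  rw [h]
  exact (intervalIntegral.integral_hasDerivAt_right
    (integrable_gaussianPDFReal 0 1).intervalIntegrable
    (stronglyMeasurable_gaussianPDFReal 0 1).stronglyMeasurableAtFilter
    continuous_gpdf.continuousAt).const_add _

theorem gpdf_le_one (t : ℝ) : gpdf t ≤ 1 := by
  rw [gpdf_eq]
  have h1 : 1 ≤ √(2 * Real.pi) := by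
    rw [Real.one_le_sqrt]
    nlinarith [Real.pi_gt_three]
  have h2 : Real.exp (-t ^ 2 / 2) ≤ 1 := by
    rw [Real.exp_le_one_iff]
    nlinarith [sq_nonneg t]
  calc _ ≤ 1 * 1 := mul_le_mul (inv_le_one_of_one_le₀ h1) h2 (Real.exp_nonneg _) zero_le_one
    _ = 1 := one_mul _

theorem normalCDF_add_le (x : ℝ) {δ : ℝ} (hδ : 0 ≤ δ) : normalCDF (x + δ) ≤ normalCDF x + δ := by
  have := Convex.norm_image_sub_le_of_norm_hasDerivWithin_le (f := normalCDF) (f' := gpdf)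
    (s := univ) (C := 1)
    (fun x _ => (hasDerivAt_normalCDF x).hasDerivWithinAt)
    (fun x _ => by rw [Real.norm_eq_abs, abs_of_pos (gpdf_pos x)]; exact gpdf_le_one x)
    convex_univ (mem_univ x) (mem_univ (x + δ))
  rw [add_sub_cancel_left, Real.norm_eq_abs, Real.norm_eq_abs, abs_of_nonneg hδ] at this
  linarith [le_abs_self (normalCDF (x + δ) - normalCDF x)]

theorem gpdf_neg (t : ℝ) : gpdf (-t) = gpdf t := by simp [gpdf_eq]

theorem normalCDF_neg (x : ℝ) : normalCDF (-x) = 1 - normalCDF x := by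
  rw [normalCDF_eq_integral, one_sub_normalCDF_eq_integral, ← integral_comp_neg_Ioi]
  simp [gpdf_neg]

/-- The Mills ratio bound. For `w > 0` it follows from
`∫_w^∞ w p(t) dt ≤ ∫_w^∞ t p(t) dt = p(w)`. -/
theorem mul_one_sub_normalCDF_le {w : ℝ} : w * (1 - normalCDF w) ≤ gpdf w := by
  have hlim : Filter.Tendsto (fun t => -gpdf t) Filter.atTop (nhds 0) := by
    have h : Filter.Tendsto (fun t : ℝ => -((√(2 * Real.pi))⁻¹ * Real.exp (-(t ^ 2 / 2))))
        Filter.atTop (nhds (-((√(2 * Real.pi))⁻¹ * 0))) := by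
      refine Filter.Tendsto.neg (Filter.Tendsto.const_mul _ ?_)
      exact Real.tendsto_exp_neg_atTop_nhds_zero.comp
        ((Filter.tendsto_pow_atTop two_ne_zero).atTop_div_const two_pos)
    simpa [gpdf_eq, neg_div] using h
  have hd : ∀ t ∈ Ici w, HasDerivAt (fun t => -gpdf t) (t * gpdf t) t := fun t _ => by
    simpa using! (hasDerivAt_gpdf t).neg
  by_cases hw : 0 ≤ w
  · have hi : IntegrableOn (fun t => t * gpdf t) (Ioi w) :=
      integrableOn_Ioi_deriv_of_nonneg' hd
        (fun t ht => mul_nonneg (hw.trans (le_of_lt ht)) (gpdf_pos t).le) hlim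
    have he := integral_Ioi_of_hasDerivAt_of_tendsto' hd hi hlim
    rw [one_sub_normalCDF_eq_integral, ← integral_const_mul]
    calc ∫ t in Ioi w, w * gpdf t ≤ ∫ t in Ioi w, t * gpdf t := by
          refine setIntegral_mono_on ((integrable_gaussianPDFReal 0 1).integrableOn.const_mul w) hi
            measurableSet_Ioi fun t ht => ?_
          exact mul_le_mul_of_nonneg_right (le_of_lt ht) (gpdf_pos t).le
      _ = gpdf w := by rw [he]; ring
  · have := normalCDF_le_one w
    nlinarith [gpdf_pos w]

theorem one_le_six_mul_gpdf {w : ℝ} (hw : |w| ≤ 1) : 1 ≤ 6 * gpdf w := by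
  rw [gpdf_eq]
  have h2 : w ^ 2 ≤ 1 := by rw [← sq_abs]; nlinarith [abs_nonneg w]
  have h1 : √(2 * Real.pi) ≤ 3 := by
    rw [Real.sqrt_le_left (by norm_num)]
    linarith [Real.pi_lt_four]
  have h1' : 0 < √(2 * Real.pi) := by positivity
  have h3 : 1 / 2 ≤ Real.exp (-w ^ 2 / 2) := by
    have := Real.add_one_le_exp (-w ^ 2 / 2)
    linarith
  rw [← mul_assoc, mul_comm (6 : ℝ), mul_assoc, inv_mul_eq_div, le_div_iff₀ h1']
  linarith

/-- The factor `6` comes from the crude bound `p ≥ 1/6` on `[-1, 1]`; beyond `1` the Mills ratio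
bound applies. -/
theorem one_sub_normalCDF_le {w : ℝ} (hw : 0 ≤ w) : 1 - normalCDF w ≤ 6 * gpdf w := by
  rcases le_total w 1 with h | h
  · have := one_le_six_mul_gpdf (w := w) (by rwa [abs_of_nonneg hw])
    linarith [normalCDF_nonneg w]
  · have := mul_one_sub_normalCDF_le (w := w)
    nlinarith [normalCDF_le_one w, gpdf_pos w]

theorem normalCDF_mul_one_sub_le (w : ℝ) :
    normalCDF w * (1 - normalCDF w) ≤ 6 * gpdf w ∧
      |w| * (normalCDF w * (1 - normalCDF w)) ≤ gpdf w := by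
  have key : ∀ w : ℝ, 0 ≤ w → normalCDF w * (1 - normalCDF w) ≤ 6 * gpdf w ∧
      |w| * (normalCDF w * (1 - normalCDF w)) ≤ gpdf w := by
    intro w hw
    have h1 := normalCDF_nonneg w
    have h2 := normalCDF_le_one w
    have h3 := one_sub_normalCDF_le hw
    have h4 := mul_one_sub_normalCDF_le (w := w)
    rw [abs_of_nonneg hw]
    have h5 : normalCDF w * (1 - normalCDF w) ≤ 1 - normalCDF w := by nlinarith
    exact ⟨h5.trans h3, (mul_le_mul_of_nonneg_left h5 hw).trans h4⟩
  rcases le_total 0 w with hw | hw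
  · exact key w hw
  · have := key (-w) (by linarith)
    rw [normalCDF_neg, gpdf_neg, abs_neg] at this
    rwa [sub_sub_cancel, mul_comm (1 - _)] at this

/-- The bounded solution `g` of Stein's equation `g'(w) - w g(w) = 1_{w ≤ x} - Φ(x)` for the
half-line `(-∞, x]`. -/
noncomputable def steinSolution (x w : ℝ) : ℝ :=
  normalCDF (min w x) * (1 - normalCDF (max w x)) / gpdf w

theorem steinSolution_nonneg (x w : ℝ) : 0 ≤ steinSolution x w :=
  div_nonneg (mul_nonneg (normalCDF_nonneg _) (sub_nonneg.2 (normalCDF_le_one _)))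
    (gpdf_pos w).le

theorem steinSolution_num_le (x w : ℝ) : normalCDF (min w x) * (1 - normalCDF (max w x)) ≤
    normalCDF w * (1 - normalCDF w) :=
  mul_le_mul (normalCDF_mono (min_le_left _ _))
    (sub_le_sub_left (normalCDF_mono (le_max_left _ _)) _)
    (sub_nonneg.2 (normalCDF_le_one _)) (normalCDF_nonneg _)

theorem abs_steinSolution_le (x w : ℝ) : |steinSolution x w| ≤ 6 := by
  rw [abs_of_nonneg (steinSolution_nonneg x w), steinSolution, div_le_iff₀ (gpdf_pos w)]
  exact (steinSolution_num_le x w).trans (normalCDF_mul_one_sub_le w).1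

theorem abs_mul_steinSolution_le (x w : ℝ) : |w * steinSolution x w| ≤ 1 := by
  rw [abs_mul, abs_of_nonneg (steinSolution_nonneg x w), steinSolution, ← mul_div_assoc,
    div_le_iff₀ (gpdf_pos w), one_mul]
  exact (mul_le_mul_of_nonneg_left (steinSolution_num_le x w) (abs_nonneg w)).trans
    (normalCDF_mul_one_sub_le w).2

/-- Stein's equation in integrated form: the kink of `steinSolution x` at `x` is that of
`w ↦ min w x`, so that after subtracting it the function is differentiable everywhere, with
derivative `w g(w)`. -/
theorem hasDerivAt_steinSolution_add (x w : ℝ) :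
    HasDerivAt (fun w => steinSolution x w + normalCDF x * w - min w x)
      (w * steinSolution x w) w := by
  have hA : ∀ w, HasDerivAt (fun w => (1 - normalCDF x) * (normalCDF w / gpdf w) -
      (1 - normalCDF x) * w) (w * ((1 - normalCDF x) * (normalCDF w / gpdf w))) w := by
    intro w
    have := (((hasDerivAt_normalCDF w).div (hasDerivAt_gpdf w) (gpdf_pos w).ne').const_mul
      (1 - normalCDF x)).sub ((hasDerivAt_id w).const_mul (1 - normalCDF x))
    refine this.congr_deriv ?_
    have := (gpdf_pos w).ne'
    field_simp
    ring
  have hB : ∀ w, HasDerivAt (fun w => normalCDF x * ((1 - normalCDF w) / gpdf w) +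
      normalCDF x * w - x) (w * (normalCDF x * ((1 - normalCDF w) / gpdf w))) w := by
    intro w
    have := (((((hasDerivAt_normalCDF w).const_sub 1).div (hasDerivAt_gpdf w)
      (gpdf_pos w).ne').const_mul (normalCDF x)).add
        ((hasDerivAt_id w).const_mul (normalCDF x))).sub_const x
    refine this.congr_deriv ?_
    have := (gpdf_pos w).ne'
    field_simp
    ring
  have eA : ∀ w ≤ x, steinSolution x w = (1 - normalCDF x) * (normalCDF w / gpdf w) := by
    intro w hw
    rw [steinSolution, min_eq_left hw, max_eq_right hw]; ring
  have eB : ∀ w, x ≤ w → steinSolution x w = normalCDF x * ((1 - normalCDF w) / gpdf w) := by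
    intro w hw
    rw [steinSolution, min_eq_right hw, max_eq_left hw]; ring
  have hA' : ∀ w ≤ x, HasDerivWithinAt (fun w => steinSolution x w + normalCDF x * w - min w x)
      (w * steinSolution x w) (Iic x) w := by
    intro w hw
    rw [eA w hw]
    refine (hA w).hasDerivWithinAt.congr (fun y hy => ?_) ?_
    · rw [eA y hy, min_eq_left hy]; ring
    · rw [eA w hw, min_eq_left hw]; ring
  have hB' : ∀ w, x ≤ w → HasDerivWithinAt
      (fun w => steinSolution x w + normalCDF x * w - min w x)
      (w * steinSolution x w) (Ici x) w := by
    intro w hw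
    rw [eB w hw]
    refine (hB w).hasDerivWithinAt.congr (fun y hy => ?_) ?_
    · rw [eB y hy, min_eq_right hy]
    · rw [eB w hw, min_eq_right hw]
  rcases lt_trichotomy w x with h | h | h
  · exact (hA' w h.le).hasDerivAt (Iic_mem_nhds h)
  · have := (hA' w h.le).union (hB' w h.ge)
    rwa [Iic_union_Ici, hasDerivWithinAt_univ] at this
  · exact (hB' w h.le).hasDerivAt (Ici_mem_nhds h)

theorem abs_steinSolution_sub_le (x a b : ℝ) :
    |steinSolution x b - steinSolution x a| ≤ 2 * |b - a| := by
  have := Convex.norm_image_sub_le_of_norm_hasDerivWithin_le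
    (s := univ) (C := 1) (fun w _ => (hasDerivAt_steinSolution_add x w).hasDerivWithinAt)
    (fun w _ => abs_mul_steinSolution_le x w) convex_univ (mem_univ a) (mem_univ b)
  simp only [Real.norm_eq_abs] at this
  have h0 := normalCDF_nonneg x
  have h1 := normalCDF_le_one x
  have h2 : |normalCDF x * (b - a) - (min b x - min a x)| ≤ |b - a| := by
    rcases le_total a b with h | h
    · have m1 : min a x ≤ min b x := min_le_min_right x h
      have m2 : min b x - min a x ≤ b - a := by
        rcases le_total a x with h' | h' <;> rcases le_total b x with h'' | h'' <;>
          simp only [min_eq_left, min_eq_right, *] <;> linarith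
      rw [abs_of_nonneg (sub_nonneg.2 h), abs_le]
      constructor <;> nlinarith
    · have m1 : min b x ≤ min a x := min_le_min_right x h
      have m2 : min a x - min b x ≤ a - b := by
        rcases le_total a x with h' | h' <;> rcases le_total b x with h'' | h'' <;>
          simp only [min_eq_left, min_eq_right, *] <;> linarith
      rw [abs_sub_comm b a, abs_of_nonneg (sub_nonneg.2 h), abs_le]
      constructor <;> nlinarith
  have h3 : steinSolution x b - steinSolution x a =
    (steinSolution x b + normalCDF x * b - min b x -
      (steinSolution x a + normalCDF x * a - min a x))
      - (normalCDF x * (b - a) - (min b x - min a x)) := by ring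
  rw [h3]
  refine (abs_sub _ _).trans ?_
  linarith

/-- First-order Taylor expansion of the Stein solution, with `a g(a) + 1_{a ≤ x} - Φ(x)` in the role
of `g'(a)`. The second error term is present only when `x` separates `a` from `b`. -/
theorem abs_steinSolution_taylor_le (x a b : ℝ) :
    |steinSolution x b - steinSolution x a - (a * steinSolution x a +
        (Iic x).indicator 1 a - normalCDF x) * (b - a)| ≤
      (2 * |a| + 6) * (b - a) ^ 2 +
        |b - a| * |(Iic x).indicator (1 : ℝ → ℝ) a - (Iic x).indicator 1 b| := by
  have hs : ∀ w ∈ uIcc a b, |w - a| ≤ |b - a| := fun w hw => abs_sub_left_of_mem_uIcc hw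
  have := Convex.norm_image_sub_le_of_norm_hasDerivWithin_le
    (f := fun w => (steinSolution x w + normalCDF x * w - min w x) - a * steinSolution x a * w)
    (f' := fun w => w * steinSolution x w - a * steinSolution x a)
    (s := uIcc a b) (C := (2 * |a| + 6) * |b - a|) (x := a) (y := b)
    (fun w _ => by
      simpa using! ((hasDerivAt_steinSolution_add x w).sub
        ((hasDerivAt_id w).const_mul (a * steinSolution x a))).hasDerivWithinAt)
    (fun w hw => ?_) (convex_uIcc a b) left_mem_uIcc right_mem_uIcc
  · simp only [Real.norm_eq_abs] at this
    have h2 : |(min b x - min a x) - (Iic x).indicator 1 a * (b - a)| ≤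
        |b - a| * |(Iic x).indicator (1 : ℝ → ℝ) a - (Iic x).indicator 1 b| := by
      simp only [indicator, mem_Iic, Pi.one_apply]
      rcases le_or_gt a x with h' | h' <;> rcases le_or_gt b x with h'' | h'' <;>
        simp only [h', h'', min_eq_left, min_eq_right, not_le.2, le_of_lt, if_true, if_false]
      · simp
      · rw [abs_le]
        rw [abs_of_nonneg (by linarith : 0 ≤ b - a)]
        norm_num
        constructor <;> linarith
      · rw [abs_le, abs_of_nonpos (by linarith : b - a ≤ 0)]
        norm_num
        constructor <;> linarith
      · simp
    have h3 : steinSolution x b - steinSolution x a - (a * steinSolution x a +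
        (Iic x).indicator 1 a - normalCDF x) * (b - a) =
        (steinSolution x b + normalCDF x * b - min b x - a * steinSolution x a * b -
          (steinSolution x a + normalCDF x * a - min a x - a * steinSolution x a * a)) +
        ((min b x - min a x) - (Iic x).indicator 1 a * (b - a)) := by ring
    rw [h3]
    refine (abs_add_le _ _).trans (add_le_add (this.trans_eq ?_) h2)
    rw [mul_assoc, ← sq, sq_abs]
  · have e : w * steinSolution x w - a * steinSolution x a =
      (w - a) * steinSolution x w + a * (steinSolution x w - steinSolution x a) := by ring
    rw [e, Real.norm_eq_abs]
    refine (abs_add_le _ _).trans ?_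
    rw [abs_mul, abs_mul]
    have g1 := abs_steinSolution_le x w
    have g2 := abs_steinSolution_sub_le x a w
    have g3 := hs w hw
    have g4 : |w - a| * |steinSolution x w| ≤ |b - a| * 6 :=
      mul_le_mul g3 g1 (abs_nonneg _) (abs_nonneg _)
    have g5 : |a| * |steinSolution x w - steinSolution x a| ≤ |a| * (2 * |b - a|) :=
      mul_le_mul_of_nonneg_left (g2.trans (by linarith)) (abs_nonneg a)
    linarith

end SteinSolution

/-! ### Walsh expansions and hypercontractivity on the discrete cube -/

section CubePoint

variable {ι : Type*}

/-- A sign as a real number. -/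
def sgn (u : ℤˣ) : ℝ := ((u : ℤ) : ℝ)

@[simp] theorem sgn_mul_self (u : ℤˣ) : sgn u * sgn u = 1 := by
  rcases Int.units_eq_one_or u with rfl | rfl <;> simp [sgn]

@[simp] theorem sgn_sq (u : ℤˣ) : sgn u ^ 2 = 1 := by rw [sq, sgn_mul_self]

@[simp] theorem abs_sgn (u : ℤˣ) : |sgn u| = 1 := by
  rcases Int.units_eq_one_or u with rfl | rfl <;> simp [sgn]

@[simp] theorem sgn_neg (u : ℤˣ) : sgn (-u) = -sgn u := by simp [sgn]

/-- The Walsh function `∏_{k ∈ A} x_k`. -/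
def chi (A : Finset ι) (x : ι → ℤˣ) : ℝ := ∏ k ∈ A, sgn (x k)

theorem chi_sq (A : Finset ι) (x : ι → ℤˣ) : chi A x * chi A x = 1 := by
  rw [chi, ← Finset.prod_mul_distrib]
  simp

variable [DecidableEq ι]

/-- Reversing the sign of the coordinate `k`. -/
def flipAt (k : ι) (x : ι → ℤˣ) : ι → ℤˣ := Function.update x k (-x k)

theorem flipAt_flipAt (k : ι) (x : ι → ℤˣ) : flipAt k (flipAt k x) = x := by
  simp [flipAt]

@[simp] theorem flipAt_same (k : ι) (x : ι → ℤˣ) : flipAt k x k = -x k := by simp [flipAt]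

theorem flipAt_of_ne {k l : ι} (h : l ≠ k) (x : ι → ℤˣ) : flipAt k x l = x l := by simp [flipAt, h]

theorem flipAt_comm (k l : ι) (x : ι → ℤˣ) : flipAt k (flipAt l x) = flipAt l (flipAt k x) := by
  by_cases h : k = l
  · rw [h]
  · funext j
    simp only [flipAt, Function.update_apply, h, Ne.symm h]
    split_ifs <;> simp_all

/-- The discrete Malliavin derivative in direction `k`. It does not depend on the coordinate `x_k`,
and `G = G₀ + x_k ∂_k G` with `G₀` not depending on `x_k` either. -/
noncomputable def grad (k : ι) (G : (ι → ℤˣ) → ℝ) (x : ι → ℤˣ) : ℝ :=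
  sgn (x k) * (G x - G (flipAt k x)) / 2

theorem grad_flipAt (k : ι) (G : (ι → ℤˣ) → ℝ) (x : ι → ℤˣ) :
    grad k G (flipAt k x) = grad k G x := by
  rw [grad, grad, flipAt_flipAt, flipAt_same, sgn_neg]
  ring

theorem chi_flipAt (k : ι) (A : Finset ι) (x : ι → ℤˣ) :
    chi A (flipAt k x) = if k ∈ A then -chi A x else chi A x := by
  have h : ∀ A : Finset ι, k ∉ A → chi A (flipAt k x) = chi A x := fun A hA =>
    Finset.prod_congr rfl fun l hl => by rw [flipAt_of_ne (ne_of_mem_of_not_mem hl hA)]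
  split_ifs with hk
  · rw [chi, chi, ← Finset.mul_prod_erase _ _ hk, ← Finset.mul_prod_erase _ _ hk]
    have := h (A.erase k) (Finset.notMem_erase _ _)
    rw [chi, chi] at this
    rw [this, flipAt_same, sgn_neg, neg_mul]
  · exact h A hk

theorem chi_mul_chi (A B : Finset ι) (x : ι → ℤˣ) :
    chi A x * chi B x = chi (symmDiff A B) x := by
  have hA : chi A x = chi (A \ B) x * chi (A ∩ B) x :=
    (by rw [chi, chi, chi, mul_comm, Finset.prod_inter_mul_prod_sdiff])
  have hB : chi B x = chi (B \ A) x * chi (A ∩ B) x :=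
    (by rw [Finset.inter_comm, chi, chi, chi, mul_comm, Finset.prod_inter_mul_prod_sdiff])
  have hS : chi (symmDiff A B) x = chi (A \ B) x * chi (B \ A) x := by
    rw [chi, symmDiff_def, Finset.sup_eq_union, Finset.prod_union]
    · rfl
    · exact disjoint_sdiff_sdiff
  rw [hS, hA, hB]
  linear_combination chi (A \ B) x * chi (B \ A) x * chi_sq (A ∩ B) x

theorem chi_insert {k : ι} {A : Finset ι} (h : k ∉ A) (x : ι → ℤˣ) :
    chi (insert k A) x = sgn (x k) * chi A x := by
  rw [chi, Finset.prod_insert h, chi]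

/-- The Walsh coefficients of the derivative in direction `k` of the function with Walsh
coefficients `c`. -/
def shift (k : ι) (c : Finset ι → ℝ) (A : Finset ι) : ℝ := if k ∈ A then 0 else c (insert k A)

theorem shift_eq_zero {c : Finset ι → ℝ} {d : ℕ} (hc : ∀ A, d + 1 < A.card → c A = 0) (k : ι)
    (A : Finset ι) (hA : d < A.card) : shift k c A = 0 := by
  rw [shift]
  split_ifs with hk
  · rfl
  · exact hc _ (by rw [Finset.card_insert_of_notMem hk]; omega)

end CubePoint

section Cube

variable {ι : Type*} [Fintype ι] [DecidableEq ι]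

/-- The mean of a function on the discrete cube `{-1, 1}^ι` under the uniform distribution. -/
noncomputable def avg (G : (ι → ℤˣ) → ℝ) : ℝ := (∑ x, G x) / Fintype.card (ι → ℤˣ)

theorem avg_add (G H : (ι → ℤˣ) → ℝ) : avg (fun x => G x + H x) = avg G + avg H := by
  simp only [avg, Finset.sum_add_distrib, add_div]

theorem avg_sub (G H : (ι → ℤˣ) → ℝ) : avg (fun x => G x - H x) = avg G - avg H := by
  simp only [avg, Finset.sum_sub_distrib, sub_div]

theorem avg_const_mul (a : ℝ) (G : (ι → ℤˣ) → ℝ) : avg (fun x => a * G x) = a * avg G := by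
  simp only [avg, ← Finset.mul_sum, mul_div_assoc]

theorem avg_sum {κ : Type*} (s : Finset κ) (G : κ → (ι → ℤˣ) → ℝ) :
    avg (fun x => ∑ i ∈ s, G i x) = ∑ i ∈ s, avg (G i) := by
  simp only [avg, ← Finset.sum_div]
  rw [Finset.sum_comm]

theorem avg_const (a : ℝ) : avg (fun _ : ι → ℤˣ => a) = a := by
  simp [avg]

theorem avg_mono {G H : (ι → ℤˣ) → ℝ} (h : ∀ x, G x ≤ H x) : avg G ≤ avg H :=
  div_le_div_of_nonneg_right (Finset.sum_le_sum fun x _ => h x) (by positivity)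

theorem avg_nonneg {G : (ι → ℤˣ) → ℝ} (h : ∀ x, 0 ≤ G x) : 0 ≤ avg G :=
  div_nonneg (Finset.sum_nonneg fun x _ => h x) (by positivity)

theorem abs_avg_le (G : (ι → ℤˣ) → ℝ) : |avg G| ≤ avg fun x => |G x| := by
  rw [avg, avg, abs_div, Nat.abs_cast]
  exact div_le_div_of_nonneg_right (Finset.abs_sum_le_sum_abs _ _) (by positivity)

theorem avg_mul_sq_le (G H : (ι → ℤˣ) → ℝ) :
    avg (fun x => G x * H x) ^ 2 ≤ avg (fun x => G x ^ 2) * avg fun x => H x ^ 2 := by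
  simp only [avg, div_pow, div_mul_div_comm, ← sq]
  exact div_le_div_of_nonneg_right (Finset.sum_mul_sq_le_sq_mul_sq _ _ _) (by positivity)

theorem avg_flipAt (k : ι) (G : (ι → ℤˣ) → ℝ) : avg (fun x => G (flipAt k x)) = avg G := by
  rw [avg, avg]
  congr 1
  exact Fintype.sum_equiv (Function.Involutive.toPerm _ (flipAt_flipAt k)) _ _ fun x => rfl

theorem avg_sgn_mul_eq_zero {k : ι} {H : (ι → ℤˣ) → ℝ} (hH : ∀ x, H (flipAt k x) = H x) :
    avg (fun x => sgn (x k) * H x) = 0 := by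
  have h := avg_flipAt k (fun x => sgn (x k) * H x)
  simp only [flipAt_same, sgn_neg, hH] at h
  have h2 : avg (fun x => -sgn (x k) * H x) = - avg (fun x => sgn (x k) * H x) := by
    rw [← neg_one_mul, ← avg_const_mul]
    simp
  linarith

/-- Integration by parts: multiplication by `x_k` is adjoint to `grad k` on functions which do not
depend on `x_k`. -/
theorem avg_sgn_mul_mul {k : ι} {H : (ι → ℤˣ) → ℝ} (hH : ∀ x, H (flipAt k x) = H x)
    (G : (ι → ℤˣ) → ℝ) :
    avg (fun x => sgn (x k) * H x * G x) = avg fun x => H x * grad k G x := by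
  have h := avg_flipAt k (fun x => sgn (x k) * H x * G x)
  simp only [flipAt_same, sgn_neg, hH] at h
  have h2 : avg (fun x => H x * grad k G x) =
      (avg (fun x => sgn (x k) * H x * G x) +
        avg fun x => -sgn (x k) * H x * G (flipAt k x)) / 2 := by
    rw [← avg_add, div_eq_inv_mul, ← avg_const_mul]
    congr 1
    funext x
    rw [grad]
    ring
  rw [h2, h]
  ring

theorem avg_chi (A : Finset ι) : avg (chi A) = if A = ∅ then 1 else 0 := by
  split_ifs with h
  · subst h
    simpa [chi] using! avg_const (ι := ι) 1
  · obtain ⟨k, hk⟩ := Finset.nonempty_iff_ne_empty.2 h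
    have e : chi A = fun x => sgn (x k) * chi (A.erase k) x := by
      funext x
      rw [chi, chi, Finset.mul_prod_erase A (fun l => sgn (x l)) hk]
    rw [e]
    exact avg_sgn_mul_eq_zero fun x => by rw [chi_flipAt, if_neg (Finset.notMem_erase _ _)]

/-- The function on the cube with Walsh coefficients `c`. -/
def poly (c : Finset ι → ℝ) (x : ι → ℤˣ) : ℝ := ∑ A, c A * chi A x

/-- Parseval's identity for Walsh expansions. -/
theorem avg_poly_mul_poly (c d : Finset ι → ℝ) :
    avg (fun x => poly c x * poly d x) = ∑ A, c A * d A := by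
  simp only [poly, Finset.sum_mul_sum]
  rw [avg_sum]
  refine Finset.sum_congr rfl fun A _ => ?_
  rw [avg_sum, Finset.sum_eq_single A]
  · have : ∀ x, c A * chi A x * (d A * chi A x) = c A * d A := fun x => by
      linear_combination c A * d A * chi_sq A x
    simp only [this, avg_const]
  · intro B _ hB
    have : ∀ x, c A * chi A x * (d B * chi B x) = c A * d B * chi (symmDiff A B) x := fun x => by
      rw [← chi_mul_chi]; ring
    simp only [this]
    rw [avg_const_mul, avg_chi, if_neg, mul_zero]
    rw [← Finset.bot_eq_empty, symmDiff_eq_bot]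
    exact hB.symm
  · simp

theorem avg_poly_sq (c : Finset ι → ℝ) : avg (fun x => poly c x ^ 2) = ∑ A, c A ^ 2 := by
  simp only [sq]
  exact avg_poly_mul_poly c c

theorem sum_ite_mem_eq_sum_shift {M : Type*} [AddCommMonoid M] (k : ι) (h : Finset ι → M) :
    ∑ A, (if k ∈ A then h A else 0) = ∑ A, if k ∈ A then 0 else h (insert k A) := by
  have e : ∀ A : Finset ι, (if k ∈ A then 0 else h (insert k A)) =
      if k ∉ A then h (insert k A) else 0 := fun A => (ite_not ..).symm
  simp only [e]
  rw [← Finset.sum_filter, ← Finset.sum_filter]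
  refine Finset.sum_bij' (fun A _ => A.erase k) (fun A _ => insert k A) ?_ ?_ ?_ ?_ ?_
  · simp
  · simp
  · intro A hA
    simp only [Finset.mem_filter] at hA
    exact Finset.insert_erase hA.2
  · intro A hA
    simp only [Finset.mem_filter] at hA
    exact Finset.erase_insert hA.2
  · intro A hA
    simp only [Finset.mem_filter] at hA
    rw [Finset.insert_erase hA.2]

theorem grad_poly (k : ι) (c : Finset ι → ℝ) : grad k (poly c) = poly (shift k c) := by
  funext x
  have h : poly c x - poly c (flipAt k x) = 2 * ∑ A, if k ∈ A then c A * chi A x else 0 := by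
    rw [poly, poly, ← Finset.sum_sub_distrib, Finset.mul_sum]
    refine Finset.sum_congr rfl fun A _ => ?_
    rw [chi_flipAt]
    split_ifs <;> ring
  rw [grad, h, sum_ite_mem_eq_sum_shift, poly, mul_left_comm, mul_div_cancel_left₀ _ two_ne_zero,
    Finset.mul_sum]
  refine Finset.sum_congr rfl fun A _ => ?_
  rw [shift]
  split_ifs with hk
  · ring
  · rw [chi_insert hk]
    linear_combination c (insert k A) * chi A x * sgn_mul_self (x k)

theorem sum_sum_shift_sq (c : Finset ι → ℝ) :
    ∑ k, ∑ A, shift k c A ^ 2 = ∑ A, (A.card : ℝ) * c A ^ 2 := by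
  have : ∀ k, ∑ A, shift k c A ^ 2 = ∑ A, if k ∈ A then c A ^ 2 else 0 := fun k => by
    rw [sum_ite_mem_eq_sum_shift]
    refine Finset.sum_congr rfl fun A _ => ?_
    rw [shift]
    split_ifs <;> simp
  simp only [this]
  rw [Finset.sum_comm]
  refine Finset.sum_congr rfl fun A _ => ?_
  simp

/-- The Bonami lemma for functions of the coordinates in `s`. For a new coordinate `k`, the function
is `U + x_k V` with `V` of degree one less; the odd moments in `x_k` vanish and the mixed term
`6 𝔼 U² V²` is estimated by the Cauchy–Schwarz inequality. -/
theorem avg_pow_four_le_of_finset (s : Finset ι) : ∀ (d : ℕ) (c : Finset ι → ℝ),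
    (∀ A, d < A.card → c A = 0) →
    avg (fun x => (∑ A ∈ s.powerset, c A * chi A x) ^ 4) ≤
      9 ^ d * avg (fun x => (∑ A ∈ s.powerset, c A * chi A x) ^ 2) ^ 2 := by
  induction s using Finset.induction_on with
  | empty =>
    intro d c hc
    simp only [Finset.powerset_empty, Finset.sum_singleton, chi, Finset.prod_empty, mul_one,
      avg_const]
    have : (1 : ℝ) ≤ 9 ^ d := one_le_pow₀ (by norm_num)
    nlinarith [sq_nonneg (c ∅ ^ 2)]
  | insert k s hk ih =>
    intro d c hc
    set U : (ι → ℤˣ) → ℝ := fun x => ∑ A ∈ s.powerset, c A * chi A x with hU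
    set V : (ι → ℤˣ) → ℝ := fun x => ∑ A ∈ s.powerset, c (insert k A) * chi A x with hV
    have hmem : ∀ A ∈ s.powerset, k ∉ A := fun A hA h => hk (Finset.mem_powerset.1 hA h)
    have hsplit : ∀ x, ∑ A ∈ (insert k s).powerset, c A * chi A x = U x + sgn (x k) * V x := by
      intro x
      rw [Finset.sum_powerset_insert hk, hU, hV, Finset.mul_sum]
      congr 1
      refine Finset.sum_congr rfl fun A hA => ?_
      rw [chi_insert (hmem A hA)]
      ring
    simp only [hsplit]
    have hUf : ∀ x, U (flipAt k x) = U x := fun x =>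
      Finset.sum_congr rfl fun A hA => by rw [chi_flipAt, if_neg (hmem A hA)]
    have hVf : ∀ x, V (flipAt k x) = V x := fun x =>
      Finset.sum_congr rfl fun A hA => by rw [chi_flipAt, if_neg (hmem A hA)]
    have h4 : avg (fun x => (U x + sgn (x k) * V x) ^ 4) =
        avg (fun x => U x ^ 4) + 6 * avg (fun x => U x ^ 2 * V x ^ 2) + avg fun x => V x ^ 4 := by
      have e : ∀ x, (U x + sgn (x k) * V x) ^ 4 = (U x ^ 4 + 6 * (U x ^ 2 * V x ^ 2)) + V x ^ 4 +
          sgn (x k) * (4 * U x ^ 3 * V x + 4 * U x * V x ^ 3) := fun x => by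
        linear_combination (6 * U x ^ 2 * V x ^ 2 + 4 * U x * V x ^ 3 * sgn (x k) +
          V x ^ 4 * (sgn (x k) ^ 2 + 1)) * sgn_sq (x k)
      simp only [e]
      rw [avg_add, avg_add, avg_add, avg_const_mul, avg_sgn_mul_eq_zero, add_zero]
      intro x
      rw [hUf, hVf]
    have h2 : avg (fun x => (U x + sgn (x k) * V x) ^ 2) =
        avg (fun x => U x ^ 2) + avg fun x => V x ^ 2 := by
      have e : ∀ x, (U x + sgn (x k) * V x) ^ 2 = (U x ^ 2 + V x ^ 2) +
          sgn (x k) * (2 * U x * V x) := fun x => by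
        linear_combination (V x ^ 2) * sgn_sq (x k)
      simp only [e]
      rw [avg_add, avg_add, avg_sgn_mul_eq_zero, add_zero]
      intro x
      rw [hUf, hVf]
    rw [h4, h2]
    set u := avg fun x => U x ^ 2
    set v := avg fun x => V x ^ 2
    have hu : 0 ≤ u := avg_nonneg fun x => sq_nonneg _
    have hv : 0 ≤ v := avg_nonneg fun x => sq_nonneg _
    have hU4 := ih d c hc
    rcases d with _ | d
    · have hV0 : ∀ x, V x = 0 := fun x => Finset.sum_eq_zero fun A hA => by
        rw [hc _ (by rw [Finset.card_insert_of_notMem (hmem A hA)]; omega), zero_mul]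
      have hv0 : v = 0 := by simp only [v, hV0]; simpa using avg_const (ι := ι) 0
      rw [hv0, add_zero]
      refine le_trans (le_of_eq ?_) hU4
      simp only [hV0]
      have := avg_const (ι := ι) 0
      simp [this, hU]
    · have hV4 : avg (fun x => V x ^ 4) ≤ 9 ^ d * v ^ 2 := by
        have := ih d (fun A => if k ∈ A then 0 else c (insert k A)) (fun A hA => by
          split_ifs with h
          · rfl
          · exact hc _ (by rw [Finset.card_insert_of_notMem h]; omega))
        have e : ∀ x, ∑ A ∈ s.powerset, (if k ∈ A then 0 else c (insert k A)) * chi A x = V x :=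
          fun x => Finset.sum_congr rfl fun A hA => by rw [if_neg (hmem A hA)]
        simpa only [e] using this
      have hUV : avg (fun x => U x ^ 2 * V x ^ 2) ≤ 3 * 9 ^ d * (u * v) := by
        have := avg_mul_sq_le (fun x => U x ^ 2) (fun x => V x ^ 2)
        simp only [← pow_mul] at this
        norm_num at this
        refine le_of_sq_le_sq (this.trans ((mul_le_mul hU4 hV4
          (avg_nonneg fun x => by positivity) (by positivity)).trans_eq ?_)) (by positivity)
        rw [pow_succ]
        ring
      have e1 : (9 : ℝ) ^ (d + 1) * (u + v) ^ 2 = 9 ^ (d + 1) * u ^ 2 + 6 * (3 * 9 ^ d * (u * v)) +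
        9 * (9 ^ d * v ^ 2) := by rw [pow_succ]; ring
      have e2 : 0 ≤ 9 ^ d * v ^ 2 := by positivity
      rw [e1]
      linarith

/-- The Bonami lemma: the fourth moment of a polynomial of degree `d` on the cube is at most `9 ^ d`
times the square of its second moment. -/
theorem avg_poly_pow_four_le {d : ℕ} {c : Finset ι → ℝ} (hc : ∀ A, d < A.card → c A = 0) :
    avg (fun x => poly c x ^ 4) ≤ 9 ^ d * avg (fun x => poly c x ^ 2) ^ 2 := by
  have := avg_pow_four_le_of_finset Finset.univ d c hc
  simpa only [Finset.powerset_univ] using! this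

theorem avg_poly_sq_mul_poly_sq_le {d : ℕ} {a b : Finset ι → ℝ} (ha : ∀ A, d < A.card → a A = 0)
    (hb : ∀ A, d < A.card → b A = 0) :
    avg (fun x => poly a x ^ 2 * poly b x ^ 2) ≤ 9 ^ d * ((∑ A, a A ^ 2) * ∑ A, b A ^ 2) := by
  have h1 := avg_poly_pow_four_le ha
  have h2 := avg_poly_pow_four_le hb
  rw [avg_poly_sq] at h1 h2
  have := avg_mul_sq_le (fun x => poly a x ^ 2) (fun x => poly b x ^ 2)
  simp only [← pow_mul] at this
  norm_num at this
  have s1 : 0 ≤ ∑ A, a A ^ 2 := Finset.sum_nonneg fun A _ => sq_nonneg _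
  have s2 : 0 ≤ ∑ A, b A ^ 2 := Finset.sum_nonneg fun A _ => sq_nonneg _
  refine le_of_sq_le_sq (this.trans ((mul_le_mul h1 h2
    (avg_nonneg fun x => by positivity) (by positivity)).trans_eq ?_)) (by positivity)
  ring

end Cube

/-! ### A Berry–Esseen bound on the cube -/

section SteinCube

variable {ι : Type*} [DecidableEq ι]

theorem sgn_mul_grad (k : ι) (G : (ι → ℤˣ) → ℝ) (x : ι → ℤˣ) :
    sgn (x k) * grad k G x = (G x - G (flipAt k x)) / 2 := by
  rw [grad]
  linear_combination (G x - G (flipAt k x)) / 2 * sgn_mul_self (x k)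

/-- The error in replacing `∂_k g(F)` by `g'(F) ∂_k F` in Stein's method, for `g` the Stein
solution: a Taylor remainder of order `|∂_k F|³`, and a term due to the kink of `g`, which is itself a
derivative of the indicator `1_{F ≤ y}` and is treated by integration by parts later on. -/
theorem abs_stein_remainder_le (y : ℝ) (k : ι) (F : (ι → ℤˣ) → ℝ) (x : ι → ℤˣ) :
    |grad k F x ^ 2 * (F x * steinSolution y (F x) + (Set.Iic y).indicator 1 (F x) - normalCDF y) -
      grad k F x * grad k (fun x => steinSolution y (F x)) x| ≤
    (4 * |F x| + 12) * |grad k F x| ^ 3 -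
      2 * (|grad k F x| * grad k F x * grad k (fun x => (Set.Iic y).indicator 1 (F x)) x) := by
  have hT := abs_steinSolution_taylor_le y (F x) (F (flipAt k x))
  have hs := sgn_sq (x k)
  have hg : |grad k F x| = |F (flipAt k x) - F x| / 2 := by
    rw [grad, abs_div, abs_mul, abs_sgn, one_mul, abs_sub_comm]
    norm_num
  set a := F x
  set b := F (flipAt k x)
  set G := a * steinSolution y a + (Set.Iic y).indicator 1 a - normalCDF y
  have e1 : grad k F x ^ 2 * G - grad k F x * grad k (fun x => steinSolution y (F x)) x =
      (a - b) / 4 * (steinSolution y b - steinSolution y a - G * (b - a)) := by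
    simp only [grad]
    linear_combination ((a - b) ^ 2 / 4 * G -
      (a - b) * (steinSolution y a - steinSolution y b) / 4) * hs
  have e2 : -2 * (|grad k F x| * grad k F x * grad k (fun x => (Set.Iic y).indicator 1 (F x)) x) =
      |b - a| / 4 * (|b - a| * |(Set.Iic y).indicator (1 : ℝ → ℝ) a -
        (Set.Iic y).indicator 1 b|) := by
    rw [hg]
    have h1 : grad k F x * grad k (fun x => (Set.Iic y).indicator (1 : ℝ → ℝ) (F x)) x =
        (a - b) * ((Set.Iic y).indicator (1 : ℝ → ℝ) a - (Set.Iic y).indicator 1 b) / 4 := by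
      simp only [grad]
      linear_combination (a - b) * ((Set.Iic y).indicator (1 : ℝ → ℝ) a -
        (Set.Iic y).indicator 1 b) / 4 * hs
    have h2 : (a - b) * ((Set.Iic y).indicator (1 : ℝ → ℝ) a - (Set.Iic y).indicator 1 b) =
        - (|b - a| * |(Set.Iic y).indicator (1 : ℝ → ℝ) a - (Set.Iic y).indicator 1 b|) := by
      rw [← abs_mul, abs_of_nonneg]
      · ring
      · simp only [Set.indicator, Set.mem_Iic, Pi.one_apply]
        rcases le_or_gt a y with h' | h' <;> rcases le_or_gt b y with h'' | h'' <;>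
          simp only [h', h'', not_le.2, if_true, if_false] <;> linarith
    rw [mul_assoc (_ / 2), h1, h2]
    ring
  have e3 : ∀ u v : ℝ, u - 2 * v = u + -2 * v := fun u v => by ring
  rw [e1, e3, e2, hg, abs_mul, abs_div, abs_sub_comm a b,
    abs_of_pos (by norm_num : (0 : ℝ) < 4)]
  refine (mul_le_mul_of_nonneg_left hT (by positivity)).trans_eq ?_
  have := sq_abs (b - a)
  linear_combination - (2 * |a| + 6) * |b - a| / 4 * this

variable [Fintype ι]

theorem sgn_mul_grad_poly (k : ι) (c : Finset ι → ℝ) (x : ι → ℤˣ) :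
    sgn (x k) * poly (shift k c) x = ∑ A, if k ∈ A then c A * chi A x else 0 := by
  rw [← grad_poly, sgn_mul_grad, poly, poly, ← Finset.sum_sub_distrib, Finset.sum_div]
  refine Finset.sum_congr rfl fun A _ => ?_
  rw [chi_flipAt]
  split_ifs <;> ring

/-- A homogeneous polynomial of degree `q` is an eigenfunction, with eigenvalue `q`, of the number
operator. -/
theorem sum_sgn_mul_grad_poly {q : ℕ} {c : Finset ι → ℝ} (hc : ∀ A, A.card ≠ q → c A = 0)
    (x : ι → ℤˣ) : ∑ k, sgn (x k) * poly (shift k c) x = q * poly c x := by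
  simp only [sgn_mul_grad_poly]
  rw [Finset.sum_comm, poly, Finset.mul_sum]
  refine Finset.sum_congr rfl fun A _ => ?_
  by_cases hA : A.card = q
  · simp [hA]
  · simp [hc A hA]

/-- Integration by parts for a homogeneous polynomial `F` of degree `q`:
`q 𝔼 F G = ∑_k 𝔼 (∂_k F) (∂_k G)`. -/
theorem avg_poly_mul {q : ℕ} {c : Finset ι → ℝ} (hc : ∀ A, A.card ≠ q → c A = 0)
    (G : (ι → ℤˣ) → ℝ) :
    q * avg (fun x => poly c x * G x) = ∑ k, avg fun x => poly (shift k c) x * grad k G x := by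
  have : ∀ x, (q : ℝ) * (poly c x * G x) = ∑ k, sgn (x k) * poly (shift k c) x * G x := fun x => by
    rw [← mul_assoc, ← sum_sgn_mul_grad_poly hc, Finset.sum_mul]
  rw [← avg_const_mul]
  simp only [this]
  rw [avg_sum]
  refine Finset.sum_congr rfl fun k _ => avg_sgn_mul_mul (fun x => ?_) G
  rw [← grad_poly, grad_flipAt]

theorem abs_abs_mul_sub_le (a b : ℝ) : |(|a| * a - |b| * b)| ≤ (|a| + |b|) * |a - b| := by
  rcases abs_cases a with ⟨h1, h2⟩ | ⟨h1, h2⟩ <;> rcases abs_cases b with ⟨h3, h4⟩ | ⟨h3, h4⟩ <;>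
    rw [h1, h3] <;> rcases abs_cases (a - b) with ⟨h5, h6⟩ | ⟨h5, h6⟩ <;> rw [h5, abs_le] <;>
    constructor <;> nlinarith

/-- The function `a ↦ |a| a` has the Lipschitz constant `|a| + |b|` between `a` and `b`, so that the
derivative of `|F| F` is controlled by `F` and its derivative. -/
theorem avg_grad_abs_mul_sq_le {d : ℕ} {a : Finset ι → ℝ} (ha : ∀ A, d < A.card → a A = 0)
    (l : ι) :
    avg (fun x => grad l (fun x => |poly a x| * poly a x) x ^ 2) ≤
      4 * 9 ^ d * ((∑ A, a A ^ 2) * ∑ A, shift l a A ^ 2) := by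
  have hpt : ∀ x, grad l (fun x => |poly a x| * poly a x) x ^ 2 ≤
      2 * (poly a x ^ 2 * poly (shift l a) x ^ 2 +
        poly a (flipAt l x) ^ 2 * poly (shift l a) (flipAt l x) ^ 2) := by
    intro x
    rw [← grad_poly, grad_flipAt, grad, grad]
    set a' := poly a x
    set b' := poly a (flipAt l x)
    have h1 := pow_le_pow_left₀ (abs_nonneg _) (abs_abs_mul_sub_le a' b') 2
    rw [sq_abs, mul_pow, sq_abs] at h1
    have h2 : (|a'| + |b'|) ^ 2 ≤ 2 * (a' ^ 2 + b' ^ 2) := by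
      rw [← sq_abs a', ← sq_abs b']
      nlinarith [sq_nonneg (|a'| - |b'|)]
    have h3 := mul_le_mul_of_nonneg_right h2 (sq_nonneg (a' - b'))
    have e1 : (sgn (x l) * (|a'| * a' - |b'| * b') / 2) ^ 2 = (|a'| * a' - |b'| * b') ^ 2 / 4 := by
      linear_combination (|a'| * a' - |b'| * b') ^ 2 / 4 * sgn_sq (x l)
    have e2 : (sgn (x l) * (a' - b') / 2) ^ 2 = (a' - b') ^ 2 / 4 := by
      linear_combination (a' - b') ^ 2 / 4 * sgn_sq (x l)
    rw [e1, e2]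
    linarith
  refine (avg_mono hpt).trans ?_
  rw [avg_const_mul, avg_add, avg_flipAt l fun x => poly a x ^ 2 * poly (shift l a) x ^ 2]
  have := avg_poly_sq_mul_poly_sq_le ha (b := shift l a)
    (fun A hA => shift_eq_zero (fun B hB => ha B (by omega)) l A hA)
  linarith

/-- The divergence `∑_k x_k u_k` of `u_k = |∂_k F| ∂_k F` in `L²`. By integration by parts its
second moment is at most `∑_k 𝔼 u_k² + ∑_{k,l} 𝔼 (∂_l u_k)²`, and hypercontractivity bounds both sums by a
multiple of `∑_k (𝔼 (∂_k F)²)²`. -/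
theorem avg_divergence_sq_le {q : ℕ} (hq : 1 ≤ q) {c : Finset ι → ℝ}
    (hc : ∀ A, A.card ≠ q → c A = 0) :
    avg (fun x => (∑ k, sgn (x k) * (|poly (shift k c) x| * poly (shift k c) x)) ^ 2) ≤
      5 * q * 9 ^ q * ∑ k, (∑ A, shift k c A ^ 2) ^ 2 := by
  set u : ι → (ι → ℤˣ) → ℝ := fun k x => |poly (shift k c) x| * poly (shift k c) x with hu
  have hdeg : ∀ k A, q < A.card → shift k c A = 0 := fun k A hA =>
    shift_eq_zero (fun B hB => hc B (by omega)) k A hA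
  have huf : ∀ k x, u k (flipAt k x) = u k x := fun k x => by
    simp only [hu, ← grad_poly, grad_flipAt]
  have hgf : ∀ k l x, grad k (u l) (flipAt l x) = grad k (u l) x := fun k l x => by
    by_cases h : k = l
    · subst h; rw [grad_flipAt]
    · rw [grad, grad, flipAt_comm, huf, huf, flipAt_of_ne h]
  have hgs : ∀ k l x, k ≠ l → grad k (fun x => sgn (x l) * u l x) x = sgn (x l) * grad k (u l) x :=
    fun k l x h => by
      rw [grad, grad, flipAt_of_ne h.symm]
      ring
  have hoff : ∀ k l, k ≠ l →
      avg (fun x => sgn (x k) * u k x * (sgn (x l) * u l x)) ≤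
        (avg (fun x => grad l (u k) x ^ 2) + avg fun x => grad k (u l) x ^ 2) / 2 := by
    intro k l h
    rw [avg_sgn_mul_mul (huf k)]
    simp only [hgs k l _ h]
    have e : ∀ x, u k x * (sgn (x l) * grad k (u l) x) = sgn (x l) * grad k (u l) x * u k x :=
      fun x => by ring
    simp only [e]
    rw [avg_sgn_mul_mul (hgf k l), ← avg_add, div_eq_inv_mul, ← avg_const_mul]
    exact avg_mono fun x => by nlinarith [sq_nonneg (grad k (u l) x - grad l (u k) x)]
  have hdiag : ∀ k, avg (fun x => sgn (x k) * u k x * (sgn (x k) * u k x)) ≤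
      9 ^ q * (∑ A, shift k c A ^ 2) ^ 2 := by
    intro k
    have := avg_poly_pow_four_le (hdeg k)
    rw [avg_poly_sq] at this
    refine le_of_eq_of_le ?_ this
    congr 1
    funext x
    simp only [hu]
    have h1 := sgn_sq (x k)
    have h2 := sq_abs (poly (shift k c) x)
    linear_combination |poly (shift k c) x| ^ 2 * poly (shift k c) x ^ 2 * h1 +
      poly (shift k c) x ^ 2 * h2
  have hgrad : ∀ k, ∑ l, avg (fun x => grad l (u k) x ^ 2) ≤
      4 * q * 9 ^ q * (∑ A, shift k c A ^ 2) ^ 2 := by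
    intro k
    have h1 : ∑ l, avg (fun x => grad l (u k) x ^ 2) ≤
        ∑ l, 4 * 9 ^ q * ((∑ A, shift k c A ^ 2) * ∑ A, shift l (shift k c) A ^ 2) :=
      Finset.sum_le_sum fun l _ => avg_grad_abs_mul_sq_le (hdeg k) l
    rw [← Finset.mul_sum, ← Finset.mul_sum, sum_sum_shift_sq] at h1
    have h2 : ∑ A : Finset ι, (A.card : ℝ) * shift k c A ^ 2 ≤ q * ∑ A, shift k c A ^ 2 := by
      rw [Finset.mul_sum]
      refine Finset.sum_le_sum fun A _ => ?_
      by_cases hA : A.card ≤ q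
      · exact mul_le_mul_of_nonneg_right (by exact_mod_cast hA) (sq_nonneg _)
      · simp [hdeg k A (by omega)]
    have h3 : 0 ≤ ∑ A, shift k c A ^ 2 := Finset.sum_nonneg fun A _ => sq_nonneg _
    refine h1.trans ?_
    have := mul_le_mul_of_nonneg_left (mul_le_mul_of_nonneg_left h2 h3)
      (by positivity : (0 : ℝ) ≤ 4 * 9 ^ q)
    refine this.trans_eq (by ring)
  have hexp : ∀ x, (∑ k, sgn (x k) * u k x) ^ 2 =
      ∑ k, ∑ l, sgn (x k) * u k x * (sgn (x l) * u l x) := fun x => by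
    rw [sq, Finset.sum_mul_sum]
  have hmain : avg (fun x => (∑ k, sgn (x k) * u k x) ^ 2) ≤
      ∑ k, ∑ l, ((if k = l then 9 ^ q * (∑ A, shift k c A ^ 2) ^ 2 else 0) +
        (avg (fun x => grad l (u k) x ^ 2) + avg fun x => grad k (u l) x ^ 2) / 2) := by
    simp only [hexp]
    rw [avg_sum]
    refine Finset.sum_le_sum fun k _ => ?_
    rw [avg_sum]
    refine Finset.sum_le_sum fun l _ => ?_
    by_cases h : k = l
    · subst h
      rw [if_pos rfl]
      have : 0 ≤ avg (fun x => grad k (u k) x ^ 2) := avg_nonneg fun x => sq_nonneg _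
      linarith [hdiag k]
    · rw [if_neg h, zero_add]
      exact hoff k l h
  refine hmain.trans ?_
  simp only [Finset.sum_add_distrib, ← Finset.sum_div]
  rw [Finset.sum_comm (f := fun k l => avg fun x => grad k (u l) x ^ 2)]
  simp only [Finset.sum_ite_eq, Finset.mem_univ, if_true]
  have h1 : ∑ k, ∑ l, avg (fun x => grad l (u k) x ^ 2) ≤
      ∑ k, 4 * q * 9 ^ q * (∑ A, shift k c A ^ 2) ^ 2 := Finset.sum_le_sum fun k _ => hgrad k
  rw [← Finset.mul_sum] at h1 ⊢
  have h2 : 0 ≤ ∑ k, (∑ A, shift k c A ^ 2) ^ 2 := Finset.sum_nonneg fun A _ => sq_nonneg _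
  have h3 : (1 : ℝ) ≤ q := by exact_mod_cast hq
  have h4 : 9 ^ q * ∑ k, (∑ A, shift k c A ^ 2) ^ 2 ≤
      q * (9 ^ q * ∑ k, (∑ A, shift k c A ^ 2) ^ 2) :=
    le_mul_of_one_le_left (by positivity) h3
  linarith

/-- A Berry–Esseen bound for a homogeneous polynomial `F` of degree `q` on the cube, in terms of the
`L²`-distance from `1` of the carré du champ `(1 / q) ∑_k (∂_k F)²` and of the influences
`𝔼 (∂_k F)²`. -/
theorem abs_avg_indicator_sub_le {q : ℕ} (hq : 1 ≤ q) {c : Finset ι → ℝ}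
    (hc : ∀ A, A.card ≠ q → c A = 0) {t K : ℝ} (ht : 0 < t) (hσ : ∑ A, c A ^ 2 ≤ 2)
    (hW : avg (fun x => (1 - (∑ k, poly (shift k c) x ^ 2) / q) ^ 2) ≤ K * t ^ 2)
    (hV : ∑ k, (∑ A, shift k c A ^ 2) ^ 2 ≤ K * t ^ 2) (y : ℝ) :
    |avg (fun x => (Set.Iic y).indicator 1 (poly c x)) - normalCDF y| ≤
      (K + 1 + (9 ^ q * K / 2 + (64 * 9 ^ q + 288) * q + 5 * q * 9 ^ q * K + 1)) * t := by
  have hqr : (1 : ℝ) ≤ q := by exact_mod_cast hq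
  have hq0 : (0 : ℝ) < q := by linarith
  have hdeg : ∀ k A, q < A.card → shift k c A = 0 := fun k A hA =>
    shift_eq_zero (fun B hB => hc B (by omega)) k A hA
  have hcdeg : ∀ A, q < A.card → c A = 0 := fun A hA => hc A (by omega)
  set ind : ℝ → ℝ := (Set.Iic y).indicator 1 with hind
  set g := steinSolution y
  set gp : ℝ → ℝ := fun w => w * g w + ind w - normalCDF y with hgp
  have hind01 : ∀ w, 0 ≤ ind w ∧ ind w ≤ 1 := fun w => by
    simp only [hind, Set.indicator, Pi.one_apply]
    split_ifs <;> norm_num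
  have hgp2 : ∀ w, |gp w| ≤ 2 := fun w => by
    have h1 := abs_le.1 (abs_mul_steinSolution_le y w)
    have h2 := hind01 w
    have h3 := normalCDF_nonneg y
    have h4 := normalCDF_le_one y
    rw [abs_le]
    constructor <;> simp only [hgp] <;> linarith [h1.1, h1.2, h2.1, h2.2]
  set D : ι → (ι → ℤˣ) → ℝ := fun k => poly (shift k c) with hD
  have hDg : ∀ k, grad k (poly c) = D k := fun k => grad_poly k c
  set F := poly c
  set S : (ι → ℤˣ) → ℝ := fun x => (∑ k, D k x ^ 2) / q with hS
  have hv : ∀ k, avg (fun x => D k x ^ 2) = ∑ A, shift k c A ^ 2 := fun k => avg_poly_sq _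
  have hvsum : ∑ k, ∑ A, shift k c A ^ 2 = q * ∑ A, c A ^ 2 := by
    rw [sum_sum_shift_sq, Finset.mul_sum]
    refine Finset.sum_congr rfl fun A _ => ?_
    by_cases hA : A.card = q
    · rw [hA]
    · simp [hc A hA]
  -- Stein's equation together with integration by parts.
  have hdec : avg (fun x => ind (F x)) - normalCDF y =
      avg (fun x => gp (F x) * (1 - S x)) +
        (∑ k, avg fun x => D k x ^ 2 * gp (F x) - D k x * grad k (fun x => g (F x)) x) / q := by
    have h1 : avg (fun x => ind (F x)) - normalCDF y =
        avg (fun x => gp (F x)) - avg fun x => F x * g (F x) := by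
      rw [← avg_const (ι := ι) (normalCDF y), ← avg_sub, ← avg_sub]
      congr 1
      funext x
      simp only [hgp]
      ring
    have h2 : avg (fun x => F x * g (F x)) =
        (∑ k, avg fun x => D k x * grad k (fun x => g (F x)) x) / q := by
      rw [eq_div_iff hq0.ne', mul_comm, avg_poly_mul hc]
    have h3 : avg (fun x => gp (F x)) = avg (fun x => gp (F x) * (1 - S x)) +
        (∑ k, avg fun x => D k x ^ 2 * gp (F x)) / q := by
      rw [← avg_sum, div_eq_inv_mul, ← avg_const_mul, ← avg_add]
      congr 1
      funext x
      simp only [hS]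
      rw [← Finset.sum_mul]
      ring
    rw [h1, h2, h3]
    simp only [avg_sub, Finset.sum_sub_distrib]
    ring
  -- The inequality `2 a b ≤ a² / t + t b²` replaces Cauchy–Schwarz in each of the error terms.
  have hfirst : |avg (fun x => gp (F x) * (1 - S x))| ≤ (K + 1) * t := by
    refine (abs_avg_le _).trans ?_
    have h1 : ∀ x, |gp (F x) * (1 - S x)| ≤ t⁻¹ * (1 - S x) ^ 2 + t := fun x => by
      rw [abs_mul]
      have h2 := mul_le_mul_of_nonneg_right (hgp2 (F x)) (abs_nonneg (1 - S x))
      have h3 : t⁻¹ * (1 - S x) ^ 2 + t - 2 * |1 - S x| = t⁻¹ * (|1 - S x| - t) ^ 2 := by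
        rw [← sq_abs (1 - S x)]
        field_simp
        ring
      have h4 : 0 ≤ t⁻¹ * (|1 - S x| - t) ^ 2 := by positivity
      linarith
    refine (avg_mono h1).trans ?_
    rw [avg_add, avg_const_mul, avg_const]
    have h5 : t⁻¹ * avg (fun x => (1 - S x) ^ 2) ≤ t⁻¹ * (K * t ^ 2) :=
      mul_le_mul_of_nonneg_left hW (by positivity)
    have h6 : t⁻¹ * (K * t ^ 2) = K * t := by field_simp
    linarith
  have hsecond : |(∑ k, avg fun x => D k x ^ 2 * gp (F x) - D k x * grad k (fun x => g (F x)) x)| ≤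
      ∑ k, avg (fun x => (4 * |F x| + 12) * |D k x| ^ 3) -
        2 * ∑ k, avg (fun x => |D k x| * D k x * grad k (fun x => ind (F x)) x) := by
    refine (Finset.abs_sum_le_sum_abs _ _).trans ?_
    rw [Finset.mul_sum, ← Finset.sum_sub_distrib]
    refine Finset.sum_le_sum fun k _ => (abs_avg_le _).trans ?_
    rw [← avg_const_mul, ← avg_sub]
    refine avg_mono fun x => ?_
    have := abs_stein_remainder_le y k F x
    rwa [hDg] at this
  have hcube : ∑ k, avg (fun x => (4 * |F x| + 12) * |D k x| ^ 3) ≤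
      (9 ^ q * K / 2 + (64 * 9 ^ q + 288) * q) * t := by
    -- Hypercontractivity decouples `F²` from `(∂_k F)²` in the second summand.
    have hpt : ∀ k x, (4 * |F x| + 12) * |D k x| ^ 3 ≤
        (2 * t)⁻¹ * D k x ^ 4 +
          (16 * t * (F x ^ 2 * D k x ^ 2) + 144 * t * D k x ^ 2) := fun k x => by
      have e4 : D k x ^ 4 = |D k x| ^ 4 := ((by decide : Even 4).pow_abs _).symm
      rw [e4, ← sq_abs (D k x), ← sq_abs (F x)]
      set d := |D k x|
      set f := |F x|
      have h1 : (2 * t)⁻¹ * d ^ 4 + t / 2 * (4 * f + 12) ^ 2 * d ^ 2 - (4 * f + 12) * d ^ 3 =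
          (2 * t)⁻¹ * (d * (d - t * (4 * f + 12))) ^ 2 := by
        field_simp
        ring
      have h2 : 0 ≤ (2 * t)⁻¹ * (d * (d - t * (4 * f + 12))) ^ 2 := by positivity
      have h3 : t / 2 * (4 * f + 12) ^ 2 * d ^ 2 ≤ 16 * t * (f ^ 2 * d ^ 2) + 144 * t * d ^ 2 := by
        have : 16 * t * (f ^ 2 * d ^ 2) + 144 * t * d ^ 2 - t / 2 * (4 * f + 12) ^ 2 * d ^ 2 =
          8 * t * (d * (f - 3)) ^ 2 := by ring
        have h4 : 0 ≤ 8 * t * (d * (f - 3)) ^ 2 := by positivity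
        linarith
      linarith
    have hk : ∀ k, avg (fun x => (4 * |F x| + 12) * |D k x| ^ 3) ≤
        (2 * t)⁻¹ * (9 ^ q * (∑ A, shift k c A ^ 2) ^ 2) +
          (16 * t * (9 ^ q * ((∑ A, c A ^ 2) * ∑ A, shift k c A ^ 2)) +
            144 * t * ∑ A, shift k c A ^ 2) := fun k => by
      refine (avg_mono (hpt k)).trans ?_
      rw [avg_add, avg_add, avg_const_mul, avg_const_mul, avg_const_mul, hv]
      have h1 := avg_poly_pow_four_le (hdeg k)
      rw [avg_poly_sq] at h1
      have h2 := avg_poly_sq_mul_poly_sq_le hcdeg (hdeg k)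
      gcongr
    refine (Finset.sum_le_sum fun k _ => hk k).trans ?_
    rw [Finset.sum_add_distrib, Finset.sum_add_distrib, ← Finset.mul_sum, ← Finset.mul_sum,
      ← Finset.mul_sum, ← Finset.mul_sum, ← Finset.mul_sum, ← Finset.mul_sum, hvsum]
    have h0 : 0 ≤ ∑ A, c A ^ 2 := Finset.sum_nonneg fun A _ => sq_nonneg _
    have h1 : (2 * t)⁻¹ * (9 ^ q * ∑ k, (∑ A, shift k c A ^ 2) ^ 2) ≤
        (2 * t)⁻¹ * (9 ^ q * (K * t ^ 2)) := by gcongr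
    have h2 : (2 * t)⁻¹ * (9 ^ q * (K * t ^ 2)) = 9 ^ q * K / 2 * t := by field_simp
    have h3 : 16 * t * (9 ^ q * ((∑ A, c A ^ 2) * (q * ∑ A, c A ^ 2))) ≤
        16 * t * (9 ^ q * (2 * (q * 2))) := by gcongr
    have h4 : 144 * t * (q * ∑ A, c A ^ 2) ≤ 144 * t * (q * 2) := by gcongr
    linarith
  -- The kink term: integration by parts turns it into the divergence tested against `1_{F ≤ y}`.
  have hdiv : -2 * ∑ k, avg (fun x => |D k x| * D k x * grad k (fun x => ind (F x)) x) ≤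
      (5 * q * 9 ^ q * K + 1) * t := by
    have h1 : ∑ k, avg (fun x => |D k x| * D k x * grad k (fun x => ind (F x)) x) =
        avg fun x => (∑ k, sgn (x k) * (|D k x| * D k x)) * ind (F x) := by
      simp only [Finset.sum_mul]
      rw [avg_sum]
      refine Finset.sum_congr rfl fun k _ => (avg_sgn_mul_mul (fun x => ?_) _).symm
      simp only [← hDg, grad_flipAt]
    rw [h1, ← avg_const_mul]
    have h2 : ∀ x, -2 * ((∑ k, sgn (x k) * (|D k x| * D k x)) * ind (F x)) ≤
        t⁻¹ * (∑ k, sgn (x k) * (|D k x| * D k x)) ^ 2 + t := fun x => by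
      set δ := ∑ k, sgn (x k) * (|D k x| * D k x)
      obtain ⟨i0, i1⟩ := hind01 (F x)
      set i := ind (F x)
      have h3 : t⁻¹ * δ ^ 2 + t * i ^ 2 + 2 * (δ * i) = t⁻¹ * (δ + t * i) ^ 2 := by
        field_simp
        ring
      have h4 : 0 ≤ t⁻¹ * (δ + t * i) ^ 2 := by positivity
      have h5 : t * i ^ 2 ≤ t * 1 := mul_le_mul_of_nonneg_left (pow_le_one₀ i0 i1) ht.le
      linarith
    refine (avg_mono h2).trans ?_
    rw [avg_add, avg_const_mul, avg_const]
    have h5 : avg (fun x => (∑ k, sgn (x k) * (|D k x| * D k x)) ^ 2) ≤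
        5 * q * 9 ^ q * (K * t ^ 2) :=
      (avg_divergence_sq_le hq hc).trans (mul_le_mul_of_nonneg_left hV (by positivity))
    have h6 := mul_le_mul_of_nonneg_left h5 (inv_nonneg.2 ht.le)
    have h7 : t⁻¹ * (5 * q * 9 ^ q * (K * t ^ 2)) = 5 * q * 9 ^ q * K * t := by field_simp
    linarith
  rw [hdec]
  refine (abs_add_le _ _).trans ?_
  rw [abs_div, Nat.abs_cast]
  have h1 := div_le_self (abs_nonneg (∑ k, avg fun x => D k x ^ 2 * gp (F x) -
    D k x * grad k (fun x => g (F x)) x)) hqr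
  linarith

end SteinCube

/-! ### The variance of the carré du champ -/

section Carre

variable {ι : Type*} [DecidableEq ι]

/-- Symmetric difference with `A`, as an involution on finite sets. -/
def symmDiffEquiv (A : Finset ι) : Finset ι ≃ Finset ι where
  toFun B := symmDiff A B
  invFun B := symmDiff A B
  left_inv B := symmDiff_symmDiff_cancel_left A B
  right_inv B := symmDiff_symmDiff_cancel_left A B

theorem symmDiffEquiv_apply (A B : Finset ι) : symmDiffEquiv A B = symmDiff A B := rfl

variable [Fintype ι]

/-- The contraction `∑_R c(I ∪ R) c(J ∪ R)` of Walsh coefficients, over all `R` disjoint from `I`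
and `J`. -/
def setContraction (c : Finset ι → ℝ) (I J : Finset ι) : ℝ :=
  ∑ R ∈ (I ∪ J)ᶜ.powerset, c (I ∪ R) * c (J ∪ R)

/-- The Walsh coefficients of `∑_k (∂_k F)²`, where `F` has the Walsh coefficients `c`. -/
def gradSqCoeff (c : Finset ι → ℝ) (T : Finset ι) : ℝ :=
  ∑ A, ((A \ T).card : ℝ) * c A * c (symmDiff A T)

theorem sum_grad_sq_eq_poly (c : Finset ι → ℝ) (x : ι → ℤˣ) :
    ∑ k, poly (shift k c) x ^ 2 = poly (gradSqCoeff c) x := by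
  have h1 : ∀ k, poly (shift k c) x ^ 2 =
      ∑ A, ∑ B, (if k ∈ A ∩ B then 1 else 0) * (c A * c B * chi (symmDiff A B) x) := fun k => by
    have : poly (shift k c) x ^ 2 = (sgn (x k) * poly (shift k c) x) ^ 2 := by
      rw [mul_pow, sgn_sq, one_mul]
    rw [this, sgn_mul_grad_poly, sq, Finset.sum_mul_sum]
    refine Finset.sum_congr rfl fun A _ => Finset.sum_congr rfl fun B _ => ?_
    rw [← chi_mul_chi]
    simp only [Finset.mem_inter]
    split_ifs <;> simp_all
    ring
  simp only [h1]
  rw [Finset.sum_comm]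
  have h2 : ∀ A : Finset ι,
      ∑ k, ∑ B, (if k ∈ A ∩ B then 1 else 0) * (c A * c B * chi (symmDiff A B) x) =
      ∑ T, ((A \ T).card : ℝ) * c A * c (symmDiff A T) * chi T x := fun A => by
    rw [Finset.sum_comm]
    refine Fintype.sum_equiv (symmDiffEquiv A) _ _ fun B => ?_
    rw [← Finset.sum_mul]
    simp only [Finset.sum_ite_mem, Finset.univ_inter, Finset.sum_const, nsmul_eq_mul, mul_one,
      symmDiffEquiv_apply, symmDiff_symmDiff_cancel_left]
    have : A \ symmDiff A B = A ∩ B := by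
      ext i; simp only [Finset.mem_sdiff, Finset.mem_symmDiff, Finset.mem_inter]; tauto
    rw [this]
    ring
  simp only [h2, poly, gradSqCoeff, Finset.sum_mul]
  exact Finset.sum_comm

theorem gradSqCoeff_empty {q : ℕ} {c : Finset ι → ℝ} (hc : ∀ A, A.card ≠ q → c A = 0) :
    gradSqCoeff c ∅ = q * ∑ A, c A ^ 2 := by
  rw [gradSqCoeff, Finset.mul_sum]
  refine Finset.sum_congr rfl fun A _ => ?_
  rw [Finset.sdiff_empty, ← Finset.bot_eq_empty, symmDiff_bot]
  by_cases hA : A.card = q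
  · rw [hA]; ring
  · simp [hc A hA]

/-- Disjoint pairs of sets of the same cardinality, between `1` and `q - 1`. -/
def IsBalanced (q : ℕ) (I J : Finset ι) : Prop :=
  Disjoint I J ∧ I.card = J.card ∧ 1 ≤ I.card ∧ I.card < q

instance (q : ℕ) (I J : Finset ι) : Decidable (IsBalanced q I J) := by
  unfold IsBalanced; infer_instance

/-- For `T ≠ ∅` the coefficient is a sum of contractions over the balanced splittings of `T`: write
`A = I ∪ R` with `I = A ∩ T` and `R = A \ T`, so that `A ∆ T = (T \ I) ∪ R`. Homogeneity forces both
parts of `T` to have the same number of elements, and the weight `|R| = q - |I|` removes the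
splittings without common part `R`. -/
theorem gradSqCoeff_eq {q : ℕ} {c : Finset ι → ℝ} (hc : ∀ A, A.card ≠ q → c A = 0)
    {T : Finset ι} (hT : T ≠ ∅) :
    gradSqCoeff c T = ∑ I ∈ T.powerset with IsBalanced q I (T \ I),
      ((q : ℝ) - I.card) * setContraction c I (T \ I) := by
  have h1 : gradSqCoeff c T = ∑ I ∈ T.powerset, ∑ R ∈ Tᶜ.powerset,
      (R.card : ℝ) * (c (I ∪ R) * c ((T \ I) ∪ R)) := by
    rw [gradSqCoeff, ← Finset.sum_product']
    refine Finset.sum_bij' (fun A _ => (A ∩ T, A \ T)) (fun p _ => p.1 ∪ p.2) ?_ ?_ ?_ ?_ ?_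
    · intro A _
      simp only [Finset.mem_product, Finset.mem_powerset]
      refine ⟨Finset.inter_subset_right, fun i hi => ?_⟩
      simpa using (Finset.mem_sdiff.1 hi).2
    · simp
    · intro A _
      simp only
      rw [Finset.union_comm, Finset.sdiff_union_inter]
    · rintro ⟨I, R⟩ h
      simp only [Finset.mem_product, Finset.mem_powerset] at h
      obtain ⟨hI, hR⟩ := h
      have hR' : ∀ i, i ∈ R → i ∉ T := fun i hi => by simpa using hR hi
      refine Prod.ext ?_ ?_ <;> ext i <;>
        simp only [Finset.mem_inter, Finset.mem_union, Finset.mem_sdiff] <;>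
        have := hR' i <;> have := @hI i <;> tauto
    · intro A _
      simp only
      have e1 : A ∩ T ∪ A \ T = A := by rw [Finset.union_comm, Finset.sdiff_union_inter]
      have e2 : T \ (A ∩ T) ∪ A \ T = symmDiff A T := by
        ext i
        simp only [Finset.mem_inter, Finset.mem_union, Finset.mem_sdiff, Finset.mem_symmDiff]
        tauto
      rw [e1, e2, mul_assoc]
  rw [h1, Finset.sum_filter]
  refine Finset.sum_congr rfl fun I hI => ?_
  rw [Finset.mem_powerset] at hI
  have hu : I ∪ T \ I = T := Finset.union_sdiff_of_subset hI
  have hterm : ∀ R ∈ Tᶜ.powerset, (R.card : ℝ) * (c (I ∪ R) * c ((T \ I) ∪ R)) =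
      if IsBalanced q I (T \ I) then ((q : ℝ) - I.card) * (c (I ∪ R) * c ((T \ I) ∪ R)) else 0 := by
    intro R hR
    have hRT : Disjoint T R := by
      rw [Finset.mem_powerset] at hR
      exact (Finset.disjoint_left.2 fun i hi => by simpa using hR hi).symm
    have c1 : (I ∪ R).card = I.card + R.card :=
      Finset.card_union_of_disjoint (Finset.disjoint_of_subset_left hI hRT)
    have c2 : (T \ I ∪ R).card = (T \ I).card + R.card :=
      Finset.card_union_of_disjoint (Finset.disjoint_of_subset_left Finset.sdiff_subset hRT)
    by_cases h1 : (I ∪ R).card = q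
    · by_cases h2 : (T \ I ∪ R).card = q
      · have hcard : (R.card : ℝ) = q - I.card := by
          rw [← h1, c1]; push_cast; ring
        rw [hcard]
        split_ifs with hb
        · rfl
        · have hT0 : I.card ≠ 0 := by
            intro h0
            apply hT
            have h3 : (T \ I).card = 0 := by omega
            rw [← hu, Finset.card_eq_zero.1 h3, Finset.card_eq_zero.1 h0, Finset.union_empty]
          have hIq : I.card = q := by
            by_contra hne
            exact hb ⟨Finset.disjoint_sdiff, by omega, by omega, by omega⟩
          rw [hIq]
          simp
      · simp [hc _ h2]
    · simp [hc _ h1]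
  rw [Finset.sum_congr rfl hterm]
  split_ifs with hb
  · rw [setContraction, hu, Finset.mul_sum]
  · simp

theorem gradSqCoeff_sq_le {q : ℕ} {c : Finset ι → ℝ} (hc : ∀ A, A.card ≠ q → c A = 0)
    {T : Finset ι} (hT : T ≠ ∅) :
    gradSqCoeff c T ^ 2 ≤ 4 ^ q * q ^ 2 *
      ∑ I, if I ⊆ T ∧ IsBalanced q I (T \ I) then setContraction c I (T \ I) ^ 2 else 0 := by
  rw [gradSqCoeff_eq hc hT]
  have e : (∑ I, if I ⊆ T ∧ IsBalanced q I (T \ I) then setContraction c I (T \ I) ^ 2 else 0) =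
      ∑ I ∈ T.powerset with IsBalanced q I (T \ I), setContraction c I (T \ I) ^ 2 := by
    rw [← Finset.sum_filter]
    refine Finset.sum_congr ?_ fun _ _ => rfl
    ext I
    simp
  rw [e]
  set s := T.powerset.filter fun I => IsBalanced q I (T \ I)
  have hcs := sq_sum_le_card_mul_sum_sq (s := s)
    (f := fun I => ((q : ℝ) - I.card) * setContraction c I (T \ I))
  refine hcs.trans ?_
  rcases s.eq_empty_or_nonempty with h0 | ⟨I₀, hI₀⟩
  · simp [h0]
  · have hT2 : T.card ≤ 2 * q := by
      simp only [s, Finset.mem_filter, Finset.mem_powerset] at hI₀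
      obtain ⟨h1, h2, h3, h4, h5⟩ := hI₀
      have := Finset.card_sdiff_add_card_eq_card h1
      omega
    have hs : (s.card : ℝ) ≤ 4 ^ q := by
      have h1 : s.card ≤ 2 ^ T.card := (Finset.card_filter_le _ _).trans_eq (Finset.card_powerset T)
      have h2 : s.card ≤ 4 ^ q := by
        refine h1.trans ((Nat.pow_le_pow_right two_pos hT2).trans_eq ?_)
        rw [pow_mul]
        norm_num
      exact_mod_cast h2
    rw [mul_assoc]
    refine mul_le_mul hs ?_ (Finset.sum_nonneg fun _ _ => sq_nonneg _) (by positivity)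
    rw [Finset.mul_sum]
    refine Finset.sum_le_sum fun I hI => ?_
    rw [mul_pow]
    refine mul_le_mul_of_nonneg_right ?_ (sq_nonneg _)
    simp only [s, Finset.mem_filter, Finset.mem_powerset] at hI
    have h6 : (I.card : ℝ) ≤ q := by exact_mod_cast hI.2.2.2.2.le
    have h7 : (0 : ℝ) ≤ I.card := Nat.cast_nonneg _
    exact pow_le_pow_left₀ (by linarith) (by linarith) 2

theorem sum_gradSqCoeff_sq_le {q : ℕ} {c : Finset ι → ℝ} (hc : ∀ A, A.card ≠ q → c A = 0) :
    ∑ T ∈ Finset.univ.erase ∅, gradSqCoeff c T ^ 2 ≤ 4 ^ q * q ^ 2 *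
      ∑ I, ∑ J, if IsBalanced q I J then setContraction c I J ^ 2 else 0 := by
  have h1 : ∑ T ∈ Finset.univ.erase ∅, gradSqCoeff c T ^ 2 ≤
      ∑ T : Finset ι, 4 ^ q * (q : ℝ) ^ 2 *
        ∑ I, if I ⊆ T ∧ IsBalanced q I (T \ I) then setContraction c I (T \ I) ^ 2 else 0 := by
    refine (Finset.sum_le_sum fun T hT => gradSqCoeff_sq_le hc (Finset.ne_of_mem_erase hT)).trans
      (Finset.sum_le_sum_of_subset_of_nonneg (Finset.subset_univ _) fun T _ _ => ?_)
    refine mul_nonneg (by positivity) (Finset.sum_nonneg fun I _ => ?_)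
    split_ifs
    · exact sq_nonneg _
    · exact le_rfl
  refine h1.trans ?_
  rw [← Finset.mul_sum, Finset.sum_comm]
  refine mul_le_mul_of_nonneg_left (Finset.sum_le_sum fun I _ => ?_) (by positivity)
  -- Substitute `J = T ∆ I`, which is `T \ I` when `I ⊆ T`.
  rw [← Equiv.sum_comp (symmDiffEquiv I)
      (fun J => if IsBalanced q I J then setContraction c I J ^ 2 else 0)]
  refine Finset.sum_le_sum fun T _ => ?_
  by_cases hI : I ⊆ T
  · have e : symmDiffEquiv I T = T \ I := symmDiff_of_le hI
    simp [hI, e]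
  · simp only [hI, false_and, if_false]
    split_ifs
    · exact sq_nonneg _
    · exact le_rfl

/-- The carré du champ `(1 / q) ∑_k (∂_k F)²` has mean `∑_A c_A²`, and its variance is controlled by
the contractions of `c` over disjoint pairs. -/
theorem avg_one_sub_carre_sq_le {q : ℕ} (hq : 1 ≤ q) {c : Finset ι → ℝ}
    (hc : ∀ A, A.card ≠ q → c A = 0) :
    avg (fun x => (1 - (∑ k, poly (shift k c) x ^ 2) / q) ^ 2) ≤
      (1 - ∑ A, c A ^ 2) ^ 2 + 4 ^ q *
      ∑ I, ∑ J, if IsBalanced q I J then setContraction c I J ^ 2 else 0 := by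
  have hq0 : (0 : ℝ) < q := by exact_mod_cast hq
  set d : Finset ι → ℝ := fun T => (if T = ∅ then 1 else 0) - gradSqCoeff c T / q with hd
  have h1 : ∀ x, 1 - (∑ k, poly (shift k c) x ^ 2) / q = poly d x := fun x => by
    rw [sum_grad_sq_eq_poly]
    simp only [poly, hd, sub_mul, Finset.sum_sub_distrib, Finset.sum_div, ite_mul, one_mul,
      zero_mul, Finset.sum_ite_eq', Finset.mem_univ, if_true, chi, Finset.prod_empty]
    congr 1
    exact Finset.sum_congr rfl fun A _ => by ring
  simp only [h1]
  rw [avg_poly_sq, ← Finset.add_sum_erase _ _ (Finset.mem_univ ∅)]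
  have h2 : d ∅ = 1 - ∑ A, c A ^ 2 := by
    simp only [hd, if_true]
    rw [gradSqCoeff_empty hc, mul_div_cancel_left₀ _ hq0.ne']
  have h3 : ∑ T ∈ Finset.univ.erase ∅, d T ^ 2 =
      (∑ T ∈ Finset.univ.erase ∅, gradSqCoeff c T ^ 2) / q ^ 2 := by
    rw [Finset.sum_div]
    refine Finset.sum_congr rfl fun T hT => ?_
    simp only [hd, if_neg (Finset.ne_of_mem_erase hT)]
    ring
  rw [h2, h3]
  refine add_le_add_right ?_ _
  rw [div_le_iff₀ (by positivity)]
  refine (sum_gradSqCoeff_sq_le hc).trans_eq (by ring)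

end Carre

/-! ### Kernels on tuples and functions of sets -/

section TuplesAndSets

theorem comp_sort_eq_orderEmbOfFin {α : Type*} [LinearOrder α] {r : ℕ} {b : Fin r → α}
    (hb : Function.Injective b) (h : (Finset.univ.image b).card = r) :
    b ∘ Tuple.sort b = (Finset.univ.image b).orderEmbOfFin h :=
  Finset.orderEmbOfFin_unique h (fun _ => Finset.mem_image_of_mem _ (Finset.mem_univ _))
    ((Tuple.monotone_sort b).strictMono_of_injective (hb.comp (Equiv.injective _)))

theorem card_filter_image_eq {α : Type*} [LinearOrder α] [Fintype α] {r : ℕ} {R : Finset α}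
    (hR : R.card = r) :
    (Finset.univ.filter fun b : Fin r → α => Finset.univ.image b = R).card = r ! := by
  have h : (Finset.univ.filter fun b : Fin r → α => Finset.univ.image b = R) =
      Finset.univ.image fun σ : Equiv.Perm (Fin r) => R.orderEmbOfFin hR ∘ σ := by
    ext b
    simp only [Finset.mem_filter, Finset.mem_univ, true_and, Finset.mem_image]
    constructor
    · rintro rfl
      have hb : Function.Injective b := by
        have := Finset.card_image_iff.1 (hR.trans (Finset.card_fin r).symm)
        simpa using this
      refine ⟨(Tuple.sort b)⁻¹, ?_⟩
      rw [← comp_sort_eq_orderEmbOfFin hb hR]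
      funext k
      simp
    · rintro ⟨σ, rfl⟩
      ext j
      have := Finset.range_orderEmbOfFin R hR
      rw [Set.ext_iff] at this
      have hj := this j
      simp only [Set.mem_range, Finset.mem_coe] at hj
      rw [← hj]
      simp only [Finset.mem_image, Finset.mem_univ, true_and, Function.comp_apply]
      exact ⟨fun ⟨a, h⟩ => ⟨σ a, h⟩, fun ⟨y, h⟩ => ⟨σ.symm y, by simpa using h⟩⟩
  rw [h, Finset.card_image_of_injective, Finset.card_univ, Fintype.card_perm, Fintype.card_fin]
  intro σ τ h
  ext k
  exact congrArg Fin.val ((R.orderEmbOfFin hR).injective (congrFun h k))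

theorem mem_offDiag_iff {n : ℕ} (i : Fin n → ℕ) : i ∈ offDiag n ↔ Function.Injective i := by
  constructor
  · intro h a b hab
    by_contra hne
    exact h a b hne hab
  · intro h a b hab hne
    exact hab (h hne)

/-- The set of natural numbers below `n` corresponding to a subset of `Fin n`. -/
def natSet {n : ℕ} (A : Finset (Fin n)) : Finset ℕ := A.map Fin.valEmbedding

theorem natSet_injective {n : ℕ} : Function.Injective (natSet (n := n)) :=
  Finset.map_injective _

theorem card_natSet {n : ℕ} (A : Finset (Fin n)) : (natSet A).card = A.card := Finset.card_map _

theorem natSet_union {n : ℕ} (A B : Finset (Fin n)) : natSet (A ∪ B) = natSet A ∪ natSet B :=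
  Finset.map_union _ _

/-- Sums over tuples with distinct entries as sums over sets, each set being enumerated `r !`
times. -/
theorem tsum_offDiag {n r : ℕ} {ψ : Finset ℕ → ℝ} (hψ : ∀ R, ψ R ≠ 0 → ∀ j ∈ R, j < n) :
    ∑' a : offDiag r, ψ (Finset.univ.image a.1) =
      r ! * ∑ R : Finset (Fin n), if R.card = r then ψ (natSet R) else 0 := by
  classical
  rw [tsum_subtype (offDiag r) fun a => ψ (Finset.univ.image a)]
  set g : (Fin r → ℕ) → ℝ := (offDiag r).indicator fun a => ψ (Finset.univ.image a) with hg
  have hinj : Function.Injective fun (b : Fin r → Fin n) (k : Fin r) => (b k : ℕ) := by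
    intro b b' h
    funext k
    exact Fin.ext (congrFun h k)
  rw [← hinj.tsum_eq (f := g), tsum_fintype]
  · have himg : ∀ b : Fin r → Fin n,
        Finset.univ.image (fun k => (b k : ℕ)) = natSet (Finset.univ.image b) := fun b => by
      rw [natSet, Finset.map_eq_image, Finset.image_image]
      rfl
    have hgb : ∀ b : Fin r → Fin n, g (fun k => (b k : ℕ)) =
        if (Finset.univ.image b).card = r then ψ (natSet (Finset.univ.image b)) else 0 :=
      fun b => by
      have : (fun k => (b k : ℕ)) ∈ offDiag r ↔ (Finset.univ.image b).card = r := by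
        have h1 := Finset.card_image_iff (s := Finset.univ) (f := b)
        rw [Finset.card_univ, Fintype.card_fin, Finset.coe_univ, Set.injOn_univ] at h1
        rw [mem_offDiag_iff, h1]
        exact Fin.val_injective.of_comp_iff b
      simp only [hg, Set.indicator, this, himg]
    simp only [hgb]
    rw [← Finset.sum_fiberwise Finset.univ (fun b : Fin r → Fin n => Finset.univ.image b),
      Finset.mul_sum]
    refine Finset.sum_congr rfl fun R _ => ?_
    have h1 : ∑ b : Fin r → Fin n with Finset.univ.image b = R,
        (if (Finset.univ.image b).card = r then ψ (natSet (Finset.univ.image b)) else 0) =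
        ∑ b : Fin r → Fin n with Finset.univ.image b = R,
          if R.card = r then ψ (natSet R) else 0 :=
      Finset.sum_congr rfl fun b hb => by rw [(Finset.mem_filter.1 hb).2]
    rw [h1]
    split_ifs with hR
    · rw [Finset.sum_const, card_filter_image_eq hR, nsmul_eq_mul]
    · simp
  · intro a ha
    have h1 : ψ (Finset.univ.image a) ≠ 0 := by
      intro h0
      apply ha
      simp only [hg, Set.indicator, h0, ite_self]
    exact ⟨fun k => ⟨a k, hψ _ h1 _ (Finset.mem_image_of_mem _ (Finset.mem_univ k))⟩, rfl⟩

theorem image_glue {n r l : ℕ} (hl : l ≤ r) (hr : r ≤ n) (i : Fin (n - r) → ℕ)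
    (j : Fin (r - l) → ℕ) (a : Fin l → ℕ) :
    Finset.univ.image (glue i j a : Fin n → ℕ) =
      Finset.univ.image i ∪ Finset.univ.image j ∪ Finset.univ.image a := by
  ext m
  simp only [Finset.mem_image, Finset.mem_union, Finset.mem_univ, true_and]
  constructor
  · rintro ⟨k, rfl⟩
    by_cases h₁ : (k : ℕ) < n - r
    · exact Or.inl (Or.inl ⟨⟨k, h₁⟩, by simp [glue, h₁]⟩)
    · by_cases h₂ : (k : ℕ) < n - l
      · exact Or.inl (Or.inr ⟨⟨k - (n - r), by omega⟩, by simp [glue, h₁, h₂]⟩)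
      · exact Or.inr ⟨⟨k - (n - l), by omega⟩, by simp [glue, h₁, h₂]⟩
  · rintro ((⟨s, rfl⟩ | ⟨s, rfl⟩) | ⟨s, rfl⟩)
    · exact ⟨⟨s, by omega⟩, by simp [glue]⟩
    · refine ⟨⟨n - r + s, by omega⟩, ?_⟩
      have h₂ : n - r + (s : ℕ) < n - l := by omega
      simp [glue, h₂]
    · refine ⟨⟨n - l + s, by omega⟩, ?_⟩
      have h₁ : ¬ n - l + (s : ℕ) < n - r := by omega
      simp [glue, h₁]

/-- A symmetric function on `q`-tuples, as a function of sets; it is `0` on sets whose cardinality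
is not `q`. -/
def setKernel {q : ℕ} (f : (Fin q → ℕ) → ℝ) (A : Finset ℕ) : ℝ :=
  if h : A.card = q then f (A.orderEmbOfFin h) else 0

theorem setKernel_of_card_ne {q : ℕ} (f : (Fin q → ℕ) → ℝ) {A : Finset ℕ} (h : A.card ≠ q) :
    setKernel f A = 0 := dif_neg h

/-- No distinctness is needed: both sides vanish when `i` has repeated entries. -/
theorem IsKernel.eq_setKernel {q : ℕ} {f : (Fin q → ℕ) → ℝ} (hf : IsKernel f) (i : Fin q → ℕ) :
    f i = setKernel f (Finset.univ.image i) := by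
  have h1 := Finset.card_image_iff (s := Finset.univ) (f := i)
  rw [Finset.card_univ, Fintype.card_fin, Finset.coe_univ, Set.injOn_univ, ← mem_offDiag_iff] at h1
  rw [setKernel]
  split_ifs with h
  · rw [← comp_sort_eq_orderEmbOfFin ((mem_offDiag_iff i).1 (h1.1 h)) h, hf.symmetric]
  · exact hf.vanish i fun hi => h (h1.2 hi)

theorem setKernel_support {q n : ℕ} {f : (Fin q → ℕ) → ℝ} (hn : ∀ i, f i ≠ 0 → ∀ k, i k < n)
    {A : Finset ℕ} (hA : setKernel f A ≠ 0) : ∀ j ∈ A, j < n := by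
  rw [setKernel] at hA
  split_ifs at hA with h
  · intro j hj
    obtain ⟨k, rfl⟩ : j ∈ Set.range (A.orderEmbOfFin h) := by
      rw [Finset.range_orderEmbOfFin]; exact hj
    exact hn _ hA k
  · exact absurd rfl hA

/-- The increasing enumeration of a set of cardinality `m`, with junk value `0` for other sets. -/
def enum (m : ℕ) (A : Finset ℕ) : Fin m → ℕ :=
  if h : A.card = m then A.orderEmbOfFin h else 0

theorem image_enum {m : ℕ} {A : Finset ℕ} (h : A.card = m) : Finset.univ.image (enum m A) = A := by
  rw [enum, dif_pos h]
  apply Finset.coe_injective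
  rw [Finset.coe_image, Finset.coe_univ, Set.image_univ, Finset.range_orderEmbOfFin]

theorem enum_injective {m : ℕ} {A : Finset ℕ} (h : A.card = m) :
    Function.Injective (enum m A) := by
  rw [enum, dif_pos h]
  exact (A.orderEmbOfFin h).injective

/-- The Walsh coefficients of the part of `J_q(f)` that involves the first `n` variables only. -/
def walshCoeff {q : ℕ} (n : ℕ) (f : (Fin q → ℕ) → ℝ) (A : Finset (Fin n)) : ℝ :=
  q ! * setKernel f (natSet A)

theorem walshCoeff_eq_zero {q : ℕ} (n : ℕ) (f : (Fin q → ℕ) → ℝ) (A : Finset (Fin n))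
    (hA : A.card ≠ q) : walshCoeff n f A = 0 := by
  rw [walshCoeff, setKernel_of_card_ne f (by rwa [card_natSet]), mul_zero]

theorem l2norm_sq {κ : Type*} (g : κ → ℝ) : l2norm g ^ 2 = ∑' i, g i ^ 2 := by
  rw [l2norm, Real.sq_sqrt (tsum_nonneg fun i => sq_nonneg _)]

theorem l2norm_nonneg {κ : Type*} (g : κ → ℝ) : 0 ≤ l2norm g := Real.sqrt_nonneg _

theorem sum_walshCoeff_sq {q n : ℕ} {f : (Fin q → ℕ) → ℝ} (hf : IsKernel f)
    (hn : ∀ i, f i ≠ 0 → ∀ k, i k < n) :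
    ∑ A : Finset (Fin n), walshCoeff n f A ^ 2 = q ! * l2norm f ^ 2 := by
  have h1 : l2norm f ^ 2 = ∑' a : offDiag q, setKernel f (Finset.univ.image a.1) ^ 2 := by
    rw [l2norm_sq, tsum_subtype (offDiag q) fun a => setKernel f (Finset.univ.image a) ^ 2]
    refine tsum_congr fun i => ?_
    by_cases hi : i ∈ offDiag q
    · rw [Set.indicator_of_mem hi, hf.eq_setKernel]
    · rw [Set.indicator_of_notMem hi, hf.vanish i hi]; simp
  rw [h1, tsum_offDiag (n := n) (ψ := fun A => setKernel f A ^ 2)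
    (fun R hR => setKernel_support hn (fun h => hR (by simp [h]))), ← mul_assoc, Finset.mul_sum]
  refine Finset.sum_congr rfl fun A _ => ?_
  split_ifs with hA
  · rw [walshCoeff]; ring
  · rw [walshCoeff_eq_zero n f A hA]; simp

/-- At the enumerations of two sets of cardinality `q - r`, the contraction `f ⋆_r^r f` is the
contraction of Walsh coefficients up to a factorial factor. -/
theorem contraction_eq {q n r : ℕ} (hr : r ≤ q) {f : (Fin q → ℕ) → ℝ} (hf : IsKernel f)
    (hn : ∀ i, f i ≠ 0 → ∀ k, i k < n) {I J : Finset (Fin n)} (hI : I.card = q - r)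
    (hJ : J.card = q - r) :
    (q ! : ℝ) ^ 2 * contraction r r f f (Fin.append (Fin.append (enum (q - r) (natSet I))
      (fun _ => 0)) (enum (q - r) (natSet J))) = r ! * setContraction (walshCoeff n f) I J := by
  have hI' : (natSet I).card = q - r := by rw [card_natSet, hI]
  have hJ' : (natSet J).card = q - r := by rw [card_natSet, hJ]
  simp only [contraction, Fin.append_left, Fin.append_right]
  have h0 : (Finset.univ.image fun _ : Fin (r - r) => (0 : ℕ)) = ∅ := by
    rw [Finset.image_eq_empty, ← Finset.card_eq_zero]
    simp
  have h1 : ∀ a : offDiag r,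
      f (glue (r := r) (l := r) (enum (q - r) (natSet I)) (fun _ => 0) a) *
        f (glue (r := r) (l := r) (enum (q - r) (natSet J)) (fun _ => 0) a) =
      (fun R => setKernel f (natSet I ∪ R) * setKernel f (natSet J ∪ R))
        (Finset.univ.image a.1) := fun a => by
    rw [hf.eq_setKernel, hf.eq_setKernel (glue (enum (q - r) (natSet J)) _ _),
      image_glue le_rfl hr, image_glue le_rfl hr, image_enum hI', image_enum hJ', h0,
      Finset.union_empty, Finset.union_empty]
  rw [tsum_congr h1, tsum_offDiag (n := n)
    (ψ := fun R => setKernel f (natSet I ∪ R) * setKernel f (natSet J ∪ R))]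
  · rw [mul_left_comm, setContraction, Finset.mul_sum]
    congr 1
    have hsub : ∑ R ∈ (I ∪ J)ᶜ.powerset, walshCoeff n f (I ∪ R) * walshCoeff n f (J ∪ R) =
        ∑ R, if R ∈ (I ∪ J)ᶜ.powerset then
          walshCoeff n f (I ∪ R) * walshCoeff n f (J ∪ R) else 0 := by
      rw [Finset.sum_ite_mem, Finset.univ_inter]
    rw [hsub]
    refine Finset.sum_congr rfl fun R _ => ?_
    have e : walshCoeff n f (I ∪ R) * walshCoeff n f (J ∪ R) = (q ! : ℝ) ^ 2 *
        (setKernel f (natSet I ∪ natSet R) * setKernel f (natSet J ∪ natSet R)) := by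
      rw [walshCoeff, walshCoeff, natSet_union, natSet_union]; ring
    -- A nonzero term forces `R` to have `r` elements exactly when it is disjoint from `I` and `J`.
    by_cases h2 : setKernel f (natSet I ∪ natSet R) * setKernel f (natSet J ∪ natSet R) = 0
    · rw [e, h2]; simp
    · have hcI : (I ∪ R).card = q := by
        by_contra h
        apply h2
        rw [← natSet_union, setKernel_of_card_ne f (by rwa [card_natSet]), zero_mul]
      have hcJ : (J ∪ R).card = q := by
        by_contra h
        apply h2
        rw [← natSet_union J, setKernel_of_card_ne f (A := natSet (J ∪ R)) (by rwa [card_natSet]),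
          mul_zero]
      have hiff : R ∈ (I ∪ J)ᶜ.powerset ↔ R.card = r := by
        rw [Finset.mem_powerset]
        have e1 := Finset.card_union_add_card_inter I R
        have e2 := Finset.card_union_add_card_inter J R
        constructor
        · intro h
          have : I ∩ R = ∅ := by
            rw [← Finset.disjoint_iff_inter_eq_empty, Finset.disjoint_right]
            intro j hj hj'
            have := h hj
            simp [hj'] at this
          rw [this, Finset.card_empty] at e1
          omega
        · intro h
          have z1 : I ∩ R = ∅ := Finset.card_eq_zero.1 (by omega)
          have z2 : J ∩ R = ∅ := Finset.card_eq_zero.1 (by omega)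
          intro j hj
          simp only [Finset.mem_compl, Finset.mem_union, not_or]
          exact ⟨fun h' => by simpa [z1] using Finset.mem_inter.2 ⟨h', hj⟩,
            fun h' => by simpa [z2] using Finset.mem_inter.2 ⟨h', hj⟩⟩
      simp only [hiff, e]
      split_ifs <;> simp
  · intro R hR j hj
    exact setKernel_support hn (left_ne_zero_of_mul hR) j (Finset.mem_union_right _ hj)

theorem append_append_mem_offDiag {a b c : ℕ} {u : Fin a → ℕ} {v : Fin b → ℕ} {w : Fin c → ℕ}
    (hb : b = 0) (hu : Function.Injective u) (hw : Function.Injective w)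
    (huw : ∀ s t, u s ≠ w t) : Fin.append (Fin.append u v) w ∈ offDiag (a + b + c) := by
  subst hb
  rw [mem_offDiag_iff, Fin.append_injective_iff, Fin.append_injective_iff]
  refine ⟨⟨hu, fun s => s.elim0, fun _ s => s.elim0⟩, hw, fun s t => ?_⟩
  refine Fin.addCases (fun s => ?_) (fun s => s.elim0) s
  rw [Fin.append_left]
  exact huw s t

theorem summable_contraction_sq {q r l : ℕ} (hl : l ≤ r) (hr : r ≤ q) {f : (Fin q → ℕ) → ℝ}
    (hf : Summable fun i => f i ^ 2) : Summable fun x => contraction r l f f x ^ 2 :=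
  (summable_contraction hl hr hr hf hf).2

theorem sum_setContraction_sq_le {q n r : ℕ} (hr : r ≤ q) {f : (Fin q → ℕ) → ℝ} (hf : IsKernel f)
    (hn : ∀ i, f i ≠ 0 → ∀ k, i k < n) :
    ∑ p : Finset (Fin n) × Finset (Fin n) with
      Disjoint p.1 p.2 ∧ p.1.card = q - r ∧ p.2.card = q - r,
        setContraction (walshCoeff n f) p.1 p.2 ^ 2 ≤ (q ! : ℝ) ^ 4 * offDiagContrNorm r f ^ 2 := by
  set s := Finset.univ.filter fun p : Finset (Fin n) × Finset (Fin n) =>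
    Disjoint p.1 p.2 ∧ p.1.card = q - r ∧ p.2.card = q - r
  set e : Finset (Fin n) × Finset (Fin n) → (Fin ((q - r) + (r - r) + (q - r)) → ℕ) := fun p =>
    Fin.append (Fin.append (enum (q - r) (natSet p.1)) (fun _ => 0)) (enum (q - r) (natSet p.2))
  have hs : ∀ p ∈ s, Disjoint p.1 p.2 ∧ (natSet p.1).card = q - r ∧ (natSet p.2).card = q - r :=
    fun p hp => by
      simp only [s, Finset.mem_filter, Finset.mem_univ, true_and] at hp
      rw [card_natSet, card_natSet]
      exact hp
  have hoff : ∀ p ∈ s, e p ∈ offDiag ((q - r) + (r - r) + (q - r)) := fun p hp => by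
    obtain ⟨h1, h2, h3⟩ := hs p hp
    refine append_append_mem_offDiag (by omega) (enum_injective h2) (enum_injective h3)
      fun a b hab => ?_
    have m1 : enum (q - r) (natSet p.1) a ∈ natSet p.1 := by
      have := Finset.mem_image_of_mem (enum (q - r) (natSet p.1)) (Finset.mem_univ a)
      rwa [image_enum h2] at this
    have m2 : enum (q - r) (natSet p.2) b ∈ natSet p.2 := by
      have := Finset.mem_image_of_mem (enum (q - r) (natSet p.2)) (Finset.mem_univ b)
      rwa [image_enum h3] at this
    rw [hab] at m1
    exact Finset.disjoint_left.1 ((Finset.disjoint_map _).2 h1) m1 m2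
  have hinj : Set.InjOn e s := by
    intro p hp p' hp' h
    obtain ⟨-, h2, h3⟩ := hs p hp
    obtain ⟨-, h2', h3'⟩ := hs p' hp'
    have e1 : enum (q - r) (natSet p.1) = enum (q - r) (natSet p'.1) := by
      funext a
      simpa [e] using congrFun h (Fin.castAdd _ (Fin.castAdd _ a))
    have e2 : enum (q - r) (natSet p.2) = enum (q - r) (natSet p'.2) := by
      funext a
      simpa [e] using congrFun h (Fin.natAdd _ a)
    refine Prod.ext (natSet_injective ?_) (natSet_injective ?_)
    · rw [← image_enum h2, e1, image_enum h2']
    · rw [← image_enum h3, e2, image_enum h3']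
  set H := (offDiag ((q - r) + (r - r) + (q - r))).indicator (contraction r r f f)
  have hH : Summable fun x => H x ^ 2 := by
    refine (summable_contraction_sq le_rfl hr hf.summable_sq).of_nonneg_of_le
      (fun x => sq_nonneg _) fun x => ?_
    simp only [H, Set.indicator]
    split_ifs
    · exact le_rfl
    · simpa using sq_nonneg _
  have hle : ∀ p ∈ s,
      setContraction (walshCoeff n f) p.1 p.2 ^ 2 ≤ (q ! : ℝ) ^ 4 * H (e p) ^ 2 := by
    intro p hp
    have h0 := hs p hp
    rw [card_natSet, card_natSet] at h0
    have h1 := contraction_eq hr hf hn h0.2.1 h0.2.2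
    have h2 : H (e p) = contraction r r f f (e p) := Set.indicator_of_mem (hoff p hp) _
    rw [h2]
    have h3 : (q ! : ℝ) ^ 4 * contraction r r f f (e p) ^ 2 =
        (r ! : ℝ) ^ 2 * setContraction (walshCoeff n f) p.1 p.2 ^ 2 := by
      rw [← mul_pow, ← h1]
      ring
    rw [h3]
    refine le_mul_of_one_le_left (sq_nonneg _) (one_le_pow₀ ?_)
    exact_mod_cast Nat.succ_le_of_lt r.factorial_pos
  refine (Finset.sum_le_sum hle).trans ?_
  rw [← Finset.mul_sum, offDiagContrNorm, l2norm_sq]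
  refine mul_le_mul_of_nonneg_left ?_ (by positivity)
  rw [← Finset.sum_image (f := fun x => H x ^ 2) hinj]
  exact hH.sum_le_tsum _ fun x _ => sq_nonneg _

theorem sum_sum_shift_walshCoeff_sq_sq_le {q n : ℕ} (hq : 1 ≤ q) {f : (Fin q → ℕ) → ℝ}
    (hf : IsKernel f) (hn : ∀ i, f i ≠ 0 → ∀ k, i k < n) :
    ∑ k, (∑ A, shift k (walshCoeff n f) A ^ 2) ^ 2 ≤ (q ! : ℝ) ^ 4 * contrNorm q (q - 1) f ^ 2 := by
  set e : Fin n → (Fin ((q - q) + (q - (q - 1)) + (q - q)) → ℕ) := fun k _ => k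
  have hinj : Function.Injective e := fun k k' h =>
    Fin.ext (congrFun h ⟨0, by omega⟩)
  have hle : ∀ k, (∑ A, shift k (walshCoeff n f) A ^ 2) ^ 2 ≤
      (q ! : ℝ) ^ 4 * contraction q (q - 1) f f (e k) ^ 2 := by
    intro k
    have hemp : Finset.univ.image (fun _ : Fin (q - q) => (k : ℕ)) = ∅ := by
      rw [Finset.image_eq_empty, ← Finset.card_eq_zero]
      simp
    have hone : Finset.univ.image (fun _ : Fin (q - (q - 1)) => (k : ℕ)) = {(k : ℕ)} := by
      ext j
      simp only [Finset.mem_image, Finset.mem_univ, true_and, Finset.mem_singleton]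
      exact ⟨fun ⟨_, h⟩ => h.symm, fun h => ⟨⟨0, by omega⟩, h.symm⟩⟩
    have h1 : contraction q (q - 1) f f (e k) = ∑' a : offDiag (q - 1),
        (fun R => setKernel f ({(k : ℕ)} ∪ R) ^ 2) (Finset.univ.image a.1) := by
      simp only [contraction, e]
      refine tsum_congr fun a => ?_
      rw [hf.eq_setKernel, image_glue (by omega) le_rfl, hemp, hone, Finset.empty_union, sq]
    rw [tsum_offDiag (n := n) (ψ := fun R => setKernel f ({(k : ℕ)} ∪ R) ^ 2)
      (fun R hR j hj => setKernel_support hn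
      (left_ne_zero_of_mul (sq (setKernel f ({(k : ℕ)} ∪ R)) ▸ hR)) j
      (Finset.mem_union_right _ hj))] at h1
    have h2 : ∑ A, shift k (walshCoeff n f) A ^ 2 = (q ! : ℝ) ^ 2 *
        ∑ R : Finset (Fin n), if R.card = q - 1 then
          setKernel f ({(k : ℕ)} ∪ natSet R) ^ 2 else 0 := by
      rw [Finset.mul_sum]
      refine Finset.sum_congr rfl fun A _ => ?_
      have hins : natSet (insert k A) = {(k : ℕ)} ∪ natSet A := by
        rw [Finset.insert_eq, natSet_union]
        rfl
      rw [shift]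
      split_ifs with hk hA hA
      · have : setKernel f ({(k : ℕ)} ∪ natSet A) = 0 := by
          rw [← hins, Finset.insert_eq_of_mem hk]
          exact setKernel_of_card_ne f (by rw [card_natSet]; omega)
        rw [this]; simp
      · simp
      · rw [walshCoeff, hins]; ring
      · rw [walshCoeff_eq_zero _ _ _ (by rw [Finset.card_insert_of_notMem hk]; omega)]
        simp
    set w := ∑ R : Finset (Fin n), if R.card = q - 1 then
          setKernel f ({(k : ℕ)} ∪ natSet R) ^ 2 else 0
    rw [h1, h2]
    have h3 : (q ! : ℝ) ^ 4 * (((q - 1) ! : ℕ) * w) ^ 2 =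
      (((q - 1) ! : ℕ) : ℝ) ^ 2 * ((q ! : ℝ) ^ 2 * w) ^ 2 := by ring
    rw [h3]
    refine le_mul_of_one_le_left (sq_nonneg _) (one_le_pow₀ ?_)
    exact_mod_cast Nat.succ_le_of_lt (q - 1).factorial_pos
  refine (Finset.sum_le_sum fun k _ => hle k).trans ?_
  rw [← Finset.mul_sum, contrNorm, l2norm_sq]
  refine mul_le_mul_of_nonneg_left ?_ (by positivity)
  have hsum := summable_contraction_sq (l := q - 1) (by omega) le_rfl hf.summable_sq
  rw [← Finset.sum_image (f := fun x => contraction q (q - 1) f f x ^ 2) hinj.injOn]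
  exact hsum.sum_le_tsum _ fun x _ => sq_nonneg _

end TuplesAndSets

/-! ### Kernels of finite support and truncation -/

section Truncation

theorem sum_isBalanced_le {q n : ℕ} {f : (Fin q → ℕ) → ℝ} (hf : IsKernel f)
    (hn : ∀ i, f i ≠ 0 → ∀ k, i k < n) {t : ℝ}
    (hoff : ∀ r ∈ Finset.Icc 1 (q - 1), offDiagContrNorm r f ≤ t) :
    (∑ I, ∑ J, if IsBalanced q I J then setContraction (walshCoeff n f) I J ^ 2 else 0) ≤
      q * (q ! : ℝ) ^ 4 * t ^ 2 := by
  rw [← Finset.sum_product']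
  have h1 : ∀ p : Finset (Fin n) × Finset (Fin n),
      (if IsBalanced q p.1 p.2 then setContraction (walshCoeff n f) p.1 p.2 ^ 2 else 0) ≤
      ∑ r ∈ Finset.Icc 1 (q - 1),
        if Disjoint p.1 p.2 ∧ p.1.card = q - r ∧ p.2.card = q - r then
          setContraction (walshCoeff n f) p.1 p.2 ^ 2 else 0 := by
    intro p
    have hnn : ∀ r ∈ Finset.Icc 1 (q - 1),
        0 ≤ if Disjoint p.1 p.2 ∧ p.1.card = q - r ∧ p.2.card = q - r then
          setContraction (walshCoeff n f) p.1 p.2 ^ 2 else 0 := fun r _ => by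
      split_ifs
      · exact sq_nonneg _
      · exact le_rfl
    by_cases hb : IsBalanced q p.1 p.2
    · obtain ⟨b1, b2, b3, b4⟩ := hb
      have hmem : q - p.1.card ∈ Finset.Icc 1 (q - 1) := by
        rw [Finset.mem_Icc]; omega
      refine le_trans (le_of_eq ?_) (Finset.single_le_sum hnn hmem)
      rw [if_pos ⟨b1, b2, b3, b4⟩, if_pos ⟨b1, by omega, by omega⟩]
    · rw [if_neg hb]
      exact Finset.sum_nonneg hnn
  refine (Finset.sum_le_sum fun p _ => h1 p).trans ?_
  rw [Finset.sum_comm]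
  have h2 : ∀ r ∈ Finset.Icc 1 (q - 1),
      (∑ p ∈ Finset.univ ×ˢ Finset.univ,
        if Disjoint p.1 p.2 ∧ p.1.card = q - r ∧ p.2.card = q - r then
          setContraction (walshCoeff n f) p.1 p.2 ^ 2 else 0) ≤ (q ! : ℝ) ^ 4 * t ^ 2 := by
    intro r hr
    have hr' := Finset.mem_Icc.1 hr
    rw [Finset.univ_product_univ, ← Finset.sum_filter]
    refine (sum_setContraction_sq_le (by omega) hf hn).trans ?_
    exact mul_le_mul_of_nonneg_left (pow_le_pow_left₀ (l2norm_nonneg _) (hoff r hr) 2)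
      (by positivity)
  refine (Finset.sum_le_sum h2).trans ?_
  rw [Finset.sum_const, Nat.card_Icc, nsmul_eq_mul, ← mul_assoc]
  gcongr
  omega

/-- The factor by which the squared bound on the contraction norms is multiplied to bound the mean
squared distance of the carré du champ from `1`. -/
noncomputable def varConst (q : ℕ) : ℝ := 1 + 4 ^ q * (q * (q ! : ℝ) ^ 4)

/-- The constant in the Berry–Esseen bound. -/
noncomputable def berryEsseenConst (q : ℕ) : ℝ :=
  varConst q + 1 + (9 ^ q * varConst q / 2 + (64 * 9 ^ q + 288) * q +
    5 * q * 9 ^ q * varConst q + 1)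

theorem one_le_berryEsseenConst (q : ℕ) : 1 ≤ berryEsseenConst q := by
  have h : 0 ≤ varConst q := by rw [varConst]; positivity
  have : 0 ≤ varConst q + (9 ^ q * varConst q / 2 + (64 * 9 ^ q + 288) * q +
    5 * q * 9 ^ q * varConst q + 1) := by positivity
  rw [berryEsseenConst]
  linarith

/-- The Berry–Esseen bound for kernels of finite support, with the random signs realised on the
cube. -/
theorem abs_avg_indicator_sub_le_of_finite {q n : ℕ} (hq : 1 ≤ q) {f : (Fin q → ℕ) → ℝ}
    (hf : IsKernel f) (hn : ∀ i, f i ≠ 0 → ∀ k, i k < n) {t : ℝ} (ht : 0 < t) (ht1 : t ≤ 1)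
    (h1 : |1 - (q ! : ℝ) * l2norm f ^ 2| ≤ t)
    (h2 : ∀ r ∈ Finset.Icc 1 (q - 1), offDiagContrNorm r f ≤ t)
    (h3 : contrNorm q (q - 1) f ≤ t) (y : ℝ) :
    |avg (fun x => (Set.Iic y).indicator 1 (poly (walshCoeff n f) x)) - normalCDF y| ≤
      berryEsseenConst q * t := by
  have hqr : (1 : ℝ) ≤ q := by exact_mod_cast hq
  refine abs_avg_indicator_sub_le hq (walshCoeff_eq_zero n f) ht ?_ ?_ ?_ y
  · rw [sum_walshCoeff_sq hf hn]
    linarith [(abs_le.1 h1).1]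
  · refine (avg_one_sub_carre_sq_le hq (walshCoeff_eq_zero n f)).trans ?_
    rw [sum_walshCoeff_sq hf hn]
    have e1 : (1 - (q ! : ℝ) * l2norm f ^ 2) ^ 2 ≤ t ^ 2 := by
      rw [← sq_abs]
      exact pow_le_pow_left₀ (abs_nonneg _) h1 2
    have e2 := mul_le_mul_of_nonneg_left (sum_isBalanced_le hf hn h2)
      (by positivity : (0 : ℝ) ≤ 4 ^ q)
    rw [varConst]
    linarith
  · refine (sum_sum_shift_walshCoeff_sq_sq_le hq hf hn).trans ?_
    have e1 : (q ! : ℝ) ^ 4 * contrNorm q (q - 1) f ^ 2 ≤ (q ! : ℝ) ^ 4 * t ^ 2 :=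
      mul_le_mul_of_nonneg_left (pow_le_pow_left₀ (l2norm_nonneg _) h3 2) (by positivity)
    refine e1.trans (mul_le_mul_of_nonneg_right ?_ (sq_nonneg t))
    have e2 : (1 : ℝ) ≤ 4 ^ q := one_le_pow₀ (by norm_num)
    have e3 : (0 : ℝ) ≤ (q ! : ℝ) ^ 4 := by positivity
    have e4 : (q ! : ℝ) ^ 4 ≤ q * (q ! : ℝ) ^ 4 := le_mul_of_one_le_left e3 hqr
    have e5 : q * (q ! : ℝ) ^ 4 ≤ 4 ^ q * (q * (q ! : ℝ) ^ 4) :=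
      le_mul_of_one_le_left (by positivity) e2
    rw [varConst]
    linarith

/-- Restriction of a function to the cube `{0, …, n - 1}^q`. -/
noncomputable def truncate {q : ℕ} (n : ℕ) (f : (Fin q → ℕ) → ℝ) : (Fin q → ℕ) → ℝ :=
  {i | ∀ k, i k < n}.indicator f

variable {q : ℕ} {f : (Fin q → ℕ) → ℝ}

theorem abs_truncate_le (n : ℕ) (i : Fin q → ℕ) : |truncate n f i| ≤ |f i| := by
  rw [truncate, Set.indicator]
  split_ifs
  · exact le_rfl
  · simp

theorem truncate_ne_zero (n : ℕ) (i : Fin q → ℕ) (h : truncate n f i ≠ 0) : ∀ k, i k < n :=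
  Set.mem_of_indicator_ne_zero h

theorem IsKernel.truncate (hf : IsKernel f) (n : ℕ) : IsKernel (truncate n f) where
  summable_sq := hf.summable_sq.of_nonneg_of_le (fun i => sq_nonneg _) fun i =>
    sq_le_sq.2 (abs_truncate_le n i)
  symmetric σ i := by
    have : (∀ k, (i ∘ σ) k < n) ↔ ∀ k, i k < n :=
      ⟨fun h k => by simpa using h (σ.symm k), fun h k => h (σ k)⟩
    simp only [Rademacher.truncate, Set.indicator, Set.mem_ofPred_eq, this, hf.symmetric]
    congr
  vanish i hi := by
    rw [Rademacher.truncate, Set.indicator, hf.vanish i hi, ite_self]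

theorem tendsto_truncate (i : Fin q → ℕ) :
    Filter.Tendsto (fun n => truncate n f i) Filter.atTop (nhds (f i)) := by
  refine tendsto_const_nhds.congr' ?_
  filter_upwards [Filter.eventually_gt_atTop (Finset.univ.sup i)] with n hn
  rw [truncate, Set.indicator_of_mem]
  exact fun k => (Finset.le_sup (f := i) (Finset.mem_univ k)).trans_lt hn

theorem tendsto_l2norm_of_dominated {κ : Type*} {g : ℕ → κ → ℝ} {G b : κ → ℝ}
    (hb : Summable fun x => b x ^ 2) (hg : ∀ n x, |g n x| ≤ b x)
    (hlim : ∀ x, Filter.Tendsto (fun n => g n x) Filter.atTop (nhds (G x))) :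
    Filter.Tendsto (fun n => l2norm (g n)) Filter.atTop (nhds (l2norm G)) := by
  refine (Real.continuous_sqrt.tendsto _).comp
    (tendsto_tsum_of_dominated_convergence hb (fun x => (hlim x).pow 2)
      (Filter.Eventually.of_forall fun n x => ?_))
  rw [Real.norm_eq_abs, abs_pow]
  exact pow_le_pow_left₀ (abs_nonneg _) (hg n x) 2

theorem tendsto_l2norm_truncate (hf : Summable fun i => f i ^ 2) :
    Filter.Tendsto (fun n => l2norm (truncate n f)) Filter.atTop (nhds (l2norm f)) :=
  tendsto_l2norm_of_dominated (b := fun i => |f i|) (by simpa using hf) abs_truncate_le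
    tendsto_truncate

/-- Dominated convergence: the contraction of `|f|` with itself dominates those of all
truncations. -/
theorem tendsto_l2norm_indicator_contraction {r l : ℕ} (hl : l ≤ r) (hr : r ≤ q)
    (hf : Summable fun i => f i ^ 2) (s : Set (Fin ((q - r) + (r - l) + (q - r)) → ℕ)) :
    Filter.Tendsto
      (fun n => l2norm (s.indicator (contraction r l (truncate n f) (truncate n f))))
      Filter.atTop (nhds (l2norm (s.indicator (contraction r l f f)))) := by
  have hf' : Summable fun i => |f i| ^ 2 := by simpa using hf
  obtain ⟨hs, hs2⟩ := summable_contraction hl hr hr hf' hf'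
  have hbd : ∀ n i j, ‖truncate n f i * truncate n f j‖ ≤ |f i| * |f j| := fun n i j => by
    rw [Real.norm_eq_abs, abs_mul]
    exact mul_le_mul (abs_truncate_le n i) (abs_truncate_le n j) (abs_nonneg _) (abs_nonneg _)
  refine tendsto_l2norm_of_dominated (b := contraction r l (fun i => |f i|) fun i => |f i|) hs2
    (fun n x => ?_) fun x => ?_
  · have hle : |contraction r l (truncate n f) (truncate n f) x| ≤
        contraction r l (fun i => |f i|) (fun i => |f i|) x :=
      tsum_of_norm_bounded (hs _ _ _).hasSum fun a => hbd n _ _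
    rw [Set.indicator]
    split_ifs
    · exact hle
    · rw [abs_zero]
      exact (abs_nonneg _).trans hle
  · have hlim : Filter.Tendsto (fun n => contraction r l (truncate n f) (truncate n f) x)
        Filter.atTop (nhds (contraction r l f f x)) :=
      tendsto_tsum_of_dominated_convergence (hs _ _ _)
        (fun a => (tendsto_truncate _).mul (tendsto_truncate _))
        (Filter.Eventually.of_forall fun n a => hbd n _ _)
    by_cases hx : x ∈ s
    · simpa only [Set.indicator_of_mem hx] using hlim
    · simp only [Set.indicator_of_notMem hx]
      exact tendsto_const_nhds

theorem tendsto_offDiagContrNorm {r : ℕ} (hr : r ≤ q) (hf : Summable fun i => f i ^ 2) :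
    Filter.Tendsto (fun n => offDiagContrNorm r (truncate n f)) Filter.atTop
      (nhds (offDiagContrNorm r f)) :=
  tendsto_l2norm_indicator_contraction le_rfl hr hf _

theorem tendsto_contrNorm {r l : ℕ} (hl : l ≤ r) (hr : r ≤ q) (hf : Summable fun i => f i ^ 2) :
    Filter.Tendsto (fun n => contrNorm r l (truncate n f)) Filter.atTop
      (nhds (contrNorm r l f)) := by
  simpa only [Set.indicator_univ] using!
    tendsto_l2norm_indicator_contraction hl hr hf Set.univ

theorem walshCoeff_truncate (n : ℕ) : walshCoeff n (truncate n f) = walshCoeff n f := by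
  funext A
  rw [walshCoeff, walshCoeff, setKernel, setKernel]
  split_ifs with h
  · rw [truncate, Set.indicator_of_mem]
    intro k
    obtain ⟨a, -, ha⟩ := Finset.mem_map.1 (Finset.orderEmbOfFin_mem (natSet A) h k)
    rw [← ha]
    exact a.2
  · rfl

end Truncation

/-! ### Comparison of contraction norms -/

section ContractionNorms

variable {q : ℕ} {f : (Fin q → ℕ) → ℝ}

theorem l2norm_le_of_injective {κ κ' : Type*} {g : κ → ℝ} {h : κ' → ℝ}
    (hh : Summable fun x => h x ^ 2) {e : κ → κ'} (he : Function.Injective e)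
    (hgh : ∀ x, g x = h (e x)) : l2norm g ≤ l2norm h := by
  refine Real.sqrt_le_sqrt ?_
  simp only [hgh]
  exact (hh.comp_injective he).tsum_le_tsum_of_inj e he (fun _ _ => sq_nonneg _)
    (fun _ => le_rfl) hh

theorem offDiagContrNorm_le_contrNorm {r : ℕ} (hr : r ≤ q) (hf : Summable fun i => f i ^ 2) :
    offDiagContrNorm r f ≤ contrNorm r r f := by
  have h := summable_contraction_sq le_rfl hr hf
  have hle : ∀ x, (offDiag ((q - r) + (r - r) + (q - r))).indicator (contraction r r f f) x ^ 2 ≤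
      contraction r r f f x ^ 2 := fun x => by
    rw [Set.indicator]
    split_ifs
    · exact le_rfl
    · simpa using sq_nonneg _
  exact Real.sqrt_le_sqrt ((h.of_nonneg_of_le (fun _ => sq_nonneg _) hle).tsum_le_tsum hle h)

/-- `f ⋆_{r+1}^r f` is a restriction of `f ⋆_r^r f` to a diagonal. -/
theorem contrNorm_succ_le {r : ℕ} (hr : r + 1 ≤ q) (hf : Summable fun i => f i ^ 2) :
    contrNorm (r + 1) r f ≤ contrNorm r r f := by
  -- The last coordinate of both halves is the coordinate shared in `f ⋆_{r+1}^r f`.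
  set e : (Fin ((q - (r + 1)) + (r + 1 - r) + (q - (r + 1))) → ℕ) →
      (Fin ((q - r) + (r - r) + (q - r)) → ℕ) := fun x t =>
    if h : (t : ℕ) < q - r then x ⟨t, by omega⟩
    else if h' : (t : ℕ) < (q - r) + (q - (r + 1)) then x ⟨t, by omega⟩
    else x ⟨q - (r + 1), by omega⟩ with he
  refine l2norm_le_of_injective (summable_contraction_sq le_rfl (by omega) hf) (e := e) ?_ ?_
  · intro x y h
    funext t
    have := congrFun h ⟨t, by omega⟩
    simp only [he] at this
    split_ifs at this with h1 h2
    · exact this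
    · exact this
    · omega
  · intro x
    simp only [contraction]
    refine tsum_congr fun a => ?_
    have e1 : ∀ (u : Fin (q - (r + 1)) → ℕ) (v : Fin (r + 1 - r) → ℕ) (u' : Fin (q - r) → ℕ)
        (v' : Fin (r - r) → ℕ),
        (∀ s : Fin (q - (r + 1)), u s = u' ⟨s, by omega⟩) →
        (v ⟨0, by omega⟩ = u' ⟨q - (r + 1), by omega⟩) →
        (glue u v a.1 : Fin q → ℕ) = glue u' v' a.1 := by
      intro u v u' v' h1 h2
      funext k
      simp only [glue]
      split_ifs with g1 g2 g3
      · exact h1 ⟨k, g1⟩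
      · omega
      · have : v ⟨k - (q - (r + 1)), by omega⟩ = v ⟨0, by omega⟩ := by
          congr 2; omega
        rw [this, h2]
        congr 2
        omega
      · rfl
    congr 2
    · refine e1 _ _ _ _ (fun s => ?_) ?_
      · simp only [he, Fin.val_castAdd]
        rw [dif_pos (by omega)]
        rfl
      · simp only [he, Fin.val_castAdd]
        rw [dif_pos (by omega)]
        rfl
    · refine e1 _ _ _ _ (fun s => ?_) ?_
      · simp only [he, Fin.val_natAdd]
        rw [dif_neg (by omega), dif_pos (by omega)]
        congr 1
        ext
        simp only [Fin.val_natAdd]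
        omega
      · simp only [he, Fin.val_natAdd]
        rw [dif_neg (by omega), dif_neg (by omega)]
        rfl

/-- The kernel `f` as a function of its last variable `j` and of the other ones `i`. -/
def splitKernel (f : (Fin q → ℕ) → ℝ) (j : Fin (1 - 0) → ℕ) (i : Fin (q - 1) → ℕ) : ℝ :=
  f (glue (r := 1) (l := 0) i j Fin.elim0)

theorem summable_splitKernel_sq (hq : 1 ≤ q) (hf : Summable fun i => f i ^ 2) :
    Summable fun p : (Fin (1 - 0) → ℕ) × (Fin (q - 1) → ℕ) => splitKernel f p.1 p.2 ^ 2 := by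
  refine hf.comp_injective (i := fun p : (Fin (1 - 0) → ℕ) × (Fin (q - 1) → ℕ) =>
      (glue (r := 1) (l := 0) p.2 p.1 Fin.elim0 : Fin q → ℕ)) fun p p' h => ?_
  have := glue_injective (n := q) (r := 1) (l := 0) zero_le_one hq
    (a₁ := ((p.2, p.1), Fin.elim0)) (a₂ := ((p'.2, p'.1), Fin.elim0)) h
  simp only [Prod.mk.injEq] at this
  exact Prod.ext this.1.2 this.1.1

/-- The function `f ⋆_1^0 f` is `(i, j, k) ↦ f(i, j) f(k, j)`. -/
theorem contrNorm_one_zero_sq_le (hq : 1 ≤ q) (hf : Summable fun i => f i ^ 2) :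
    contrNorm 1 0 f ^ 2 ≤ ∑' j, (∑' i, splitKernel f j i ^ 2) ^ 2 := by
  have hGs := summable_splitKernel_sq hq hf
  have hT : Summable fun p : (Fin (1 - 0) → ℕ) × (Fin (q - 1) → ℕ) × (Fin (q - 1) → ℕ) =>
      splitKernel f p.1 p.2.1 ^ 2 * splitKernel f p.1 p.2.2 ^ 2 := by
    have hprod := Summable.mul_of_nonneg hGs hGs (fun _ => sq_nonneg _) (fun _ => sq_nonneg _)
    have hinj : Function.Injective fun p : (Fin (1 - 0) → ℕ) × (Fin (q - 1) → ℕ) ×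
        (Fin (q - 1) → ℕ) => ((p.1, p.2.1), (p.1, p.2.2)) := fun p p' h => by
      simp only [Prod.mk.injEq] at h
      exact Prod.ext h.1.1 (Prod.ext h.1.2 h.2.2)
    have h := hprod.comp_injective hinj
    simpa only [Function.comp_def] using h
  have hrow : ∀ j, Summable fun i => splitKernel f j i ^ 2 := fun j => hGs.prod_factor j
  have hmid : ∑' p : (Fin (1 - 0) → ℕ) × (Fin (q - 1) → ℕ) × (Fin (q - 1) → ℕ),
      splitKernel f p.1 p.2.1 ^ 2 * splitKernel f p.1 p.2.2 ^ 2 =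
        ∑' j, (∑' i, splitKernel f j i ^ 2) ^ 2 := by
    rw [hT.tsum_prod]
    refine tsum_congr fun j => ?_
    rw [sq, (hrow j).tsum_mul_tsum (hrow j) (hT.prod_factor j)]
  rw [← hmid]
  set e : (Fin ((q - 1) + (1 - 0) + (q - 1)) → ℕ) → (Fin (1 - 0) → ℕ) × (Fin (q - 1) → ℕ) ×
      (Fin (q - 1) → ℕ) := fun x =>
    (fun s => x (Fin.castAdd (q - 1) (Fin.natAdd (q - 1) s)),
      fun s => x (Fin.castAdd (q - 1) (Fin.castAdd (1 - 0) s)),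
      fun s => x (Fin.natAdd ((q - 1) + (1 - 0)) s)) with he
  have hinj : Function.Injective e := by
    intro x y h
    simp only [he, Prod.mk.injEq] at h
    obtain ⟨h2, h1, h3⟩ := h
    funext t
    refine Fin.addCases (fun t => ?_) (fun t => congrFun h3 t) t
    exact Fin.addCases (fun t => congrFun h1 t) (fun t => congrFun h2 t) t
  have hx : ∀ x, contraction 1 0 f f x ^ 2 =
      (fun p : (Fin (1 - 0) → ℕ) × (Fin (q - 1) → ℕ) × (Fin (q - 1) → ℕ) =>
        splitKernel f p.1 p.2.1 ^ 2 * splitKernel f p.1 p.2.2 ^ 2) (e x) := by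
    intro x
    simp only [contraction]
    rw [tsum_eq_single ⟨Fin.elim0, fun k => k.elim0⟩]
    · rw [mul_pow]
      rfl
    · intro a ha
      exact absurd (Subtype.ext (funext fun k => k.elim0)) ha
  rw [contrNorm, l2norm_sq, tsum_congr hx]
  exact (hT.comp_injective hinj).tsum_le_tsum_of_inj e hinj
    (fun _ _ => mul_nonneg (sq_nonneg _) (sq_nonneg _)) (fun _ => le_rfl) hT

theorem splitKernel_eq (hq : 1 ≤ q) (hf : IsKernel f) (j : Fin (1 - 0) → ℕ)
    (i : Fin (q - 1) → ℕ) : splitKernel f j i =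
      setKernel f ({j ⟨0, by omega⟩} ∪ Finset.univ.image i) := by
  have himj : Finset.univ.image j = {j ⟨0, by omega⟩} := by
    ext m
    simp only [Finset.mem_image, Finset.mem_univ, true_and, Finset.mem_singleton]
    refine ⟨fun ⟨s, hs⟩ => ?_, fun h => ⟨_, h.symm⟩⟩
    rw [← hs]
    exact congrArg j (Fin.ext (by omega))
  have hemp : Finset.univ.image (Fin.elim0 : Fin 0 → ℕ) = ∅ := by simp
  rw [splitKernel, hf.eq_setKernel, image_glue zero_le_one hq, himj, hemp, Finset.union_empty,
    Finset.union_comm]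

theorem splitKernel_eq_zero (hq : 1 ≤ q) (hf : IsKernel f) (j : Fin (1 - 0) → ℕ)
    {i : Fin (q - 1) → ℕ} (hi : i ∉ offDiag (q - 1)) : splitKernel f j i = 0 := by
  rw [splitKernel_eq hq hf, setKernel_of_card_ne]
  have hlt : (Finset.univ.image i).card < q - 1 := by
    refine lt_of_le_of_ne (Finset.card_image_le.trans (by simp)) fun h => hi ?_
    rw [mem_offDiag_iff, ← Set.injOn_univ, ← Finset.coe_univ, ← Finset.card_image_iff, h]
    simp
  have := Finset.card_union_le {j ⟨0, by omega⟩} (Finset.univ.image i)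
  rw [Finset.card_singleton] at this
  omega

theorem tsum_splitKernel_sq (hq : 1 ≤ q) (hf : IsKernel f) (j : Fin (1 - 0) → ℕ) :
    ∑' i, splitKernel f j i ^ 2 = contraction q (q - 1) f f fun _ => j ⟨0, by omega⟩ := by
  have hemp : Finset.univ.image (fun _ : Fin (q - q) => j ⟨0, by omega⟩) = ∅ := by
    rw [Finset.image_eq_empty, ← Finset.card_eq_zero]
    simp
  have hone : Finset.univ.image (fun _ : Fin (q - (q - 1)) => j ⟨0, by omega⟩) =
      {j ⟨0, by omega⟩} := by
    ext m
    simp only [Finset.mem_image, Finset.mem_univ, true_and, Finset.mem_singleton]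
    exact ⟨fun ⟨_, h⟩ => h.symm, fun h => ⟨⟨0, by omega⟩, h.symm⟩⟩
  have h2 : ∀ a : offDiag (q - 1), f (glue (r := q) (l := q - 1)
      (fun _ : Fin (q - q) => j ⟨0, by omega⟩) (fun _ => j ⟨0, by omega⟩) a.1) =
      splitKernel f j a.1 := fun a => by
    rw [splitKernel_eq hq hf, hf.eq_setKernel, image_glue (by omega) le_rfl, hemp, hone,
      Finset.empty_union]
  simp only [contraction, h2, ← sq]
  rw [tsum_subtype (offDiag (q - 1)) fun a => splitKernel f j a ^ 2]
  refine tsum_congr fun i => ?_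
  by_cases hi : i ∈ offDiag (q - 1)
  · rw [Set.indicator_of_mem hi]
  · rw [Set.indicator_of_notMem hi, splitKernel_eq_zero hq hf j hi]
    simp

/-- The norm of `f ⋆_1^0 f` is `(∑_j (∑_i f(i, j)²)²)^{1/2}`, which is that of `f ⋆_q^{q-1} f`. -/
theorem contrNorm_one_zero_le (hq : 1 ≤ q) (hf : IsKernel f) :
    contrNorm 1 0 f ≤ contrNorm q (q - 1) f := by
  set e : (Fin (1 - 0) → ℕ) → (Fin ((q - q) + (q - (q - 1)) + (q - q)) → ℕ) :=
    fun j _ => j ⟨0, by omega⟩ with he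
  have hinj : Function.Injective e := fun j j' h => by
    have := congrFun h ⟨0, by omega⟩
    simp only [he] at this
    funext s
    have hs : s = ⟨0, by omega⟩ := Fin.ext (by omega)
    rw [hs, this]
  have hs := summable_contraction_sq (l := q - 1) (by omega) le_rfl hf.summable_sq
  refine le_of_sq_le_sq ((contrNorm_one_zero_sq_le hq hf.summable_sq).trans ?_) (l2norm_nonneg _)
  rw [contrNorm, l2norm_sq]
  simp only [tsum_splitKernel_sq hq hf]
  exact (hs.comp_injective hinj).tsum_le_tsum_of_inj e hinj
    (fun _ _ => sq_nonneg _) (fun _ => le_rfl) hs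

theorem firstBound_le_secondBound (hq : 2 ≤ q) (hf : IsKernel f) :
    firstBound hq f ≤ secondBound hq f := by
  have hsup : ∀ r ∈ Finset.Icc 1 (q - 1), contrNorm r r f ≤ secondBound hq f := fun r hr =>
    le_max_of_le_right (Finset.le_sup' (fun r => contrNorm r r f) hr)
  have hsucc : ∀ r ∈ Finset.Icc 1 (q - 1), contrNorm (r + 1) r f ≤ secondBound hq f :=
    fun r hr => (contrNorm_succ_le (by have := Finset.mem_Icc.1 hr; omega) hf.summable_sq).trans
      (hsup r hr)
  have hlast : contrNorm q (q - 1) f ≤ secondBound hq f := by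
    have := hsucc (q - 1) (Finset.mem_Icc.2 (by omega))
    rwa [Nat.sub_add_cancel (by omega)] at this
  refine max_le (le_max_left _ _) (max_le (Finset.sup'_le _ _ fun r hr => ?_)
    (Finset.sup'_le _ _ fun r hr => ?_))
  · exact (offDiagContrNorm_le_contrNorm (by have := Finset.mem_Icc.1 hr; omega)
      hf.summable_sq).trans (hsup r hr)
  · have hr' := Finset.mem_Icc.1 hr
    obtain ⟨r, rfl⟩ : ∃ s, r = s + 1 := ⟨r - 1, by omega⟩
    rw [Nat.add_sub_cancel]
    rcases Nat.eq_zero_or_pos r with rfl | hr0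
    · exact (contrNorm_one_zero_le (by omega) hf).trans hlast
    · exact hsucc r (Finset.mem_Icc.2 (by omega))

end ContractionNorms

/-! ### Random signs, partial sums and the passage to the limit -/

section Transfer

variable {Ω : Type*} [MeasurableSpace Ω] {P : Measure Ω} [IsProbabilityMeasure P]
  {X : ℕ → Ω → ℝ}

/-- The signs of the first `n` variables, as a point of the cube; values other than `1` count as
`-1`. -/
noncomputable def signs (X : ℕ → Ω → ℝ) (n : ℕ) (ω : Ω) : Fin n → ℤˣ := fun k =>
  if X k ω = 1 then 1 else -1

/-- The signs are uniformly distributed on the cube. -/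
theorem measure_signs_eq (hX : IsRademacherSequence P X) (n : ℕ) (x : Fin n → ℤˣ) :
    MeasurableSet {ω | signs X n ω = x} ∧ P.real {ω | signs X n ω = x} = (2 ^ n : ℝ)⁻¹ := by
  set B : ℤˣ → Set ℝ := fun u => if u = 1 then {1} else {1}ᶜ with hB
  have hBm : ∀ u, MeasurableSet (B u) := fun u => by
    simp only [hB]
    split_ifs
    · exact measurableSet_singleton 1
    · exact (measurableSet_singleton 1).compl
  have hset : {ω | signs X n ω = x} = ⋂ k ∈ (Finset.univ : Finset (Fin n)),
      (fun ω => X k ω) ⁻¹' B (x k) := by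
    ext ω
    simp only [Set.mem_ofPred_eq, funext_iff, signs, Finset.mem_univ, Set.iInter_true,
      Set.mem_iInter, Set.mem_preimage]
    refine forall_congr' fun k => ?_
    rcases Int.units_eq_one_or (x k) with h | h <;> rw [h] <;> by_cases h1 : X k ω = 1 <;>
      simp [hB, h1]
  have h1 : ∀ u (k : ℕ), P (X k ⁻¹' B u) = 1 / 2 := by
    intro u k
    have hone : P (X k ⁻¹' {1}) = 1 / 2 := hX.prob_one k
    simp only [hB]
    split_ifs
    · exact hone
    · rw [Set.preimage_compl, prob_compl_eq_one_sub (hX.measurable k (measurableSet_singleton 1)),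
        hone]
      exact ENNReal.sub_half (by simp)
  constructor
  · rw [hset]
    exact Finset.measurableSet_biInter _ fun k _ => hX.measurable k (hBm _)
  · have hind : iIndepFun (fun (k : Fin n) => X k) P := hX.indep.precomp Fin.val_injective
    rw [measureReal_def, hset, hind.measure_inter_preimage_eq_mul Finset.univ fun k _ => hBm _]
    simp [h1]

theorem measureReal_signs (hX : IsRademacherSequence P X) (n : ℕ) (s : Set (Fin n → ℤˣ)) :
    P.real {ω | signs X n ω ∈ s} = avg (s.indicator 1) := by
  classical
  have h1 : {ω | signs X n ω ∈ s} = ⋃ x ∈ Finset.univ.filter (· ∈ s), {ω | signs X n ω = x} := by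
    ext ω
    simp
  rw [h1, measureReal_biUnion_finset]
  · simp only [(measure_signs_eq hX n _).2, avg, Finset.sum_const, nsmul_eq_mul]
    have : ∑ x, s.indicator (1 : (Fin n → ℤˣ) → ℝ) x = (Finset.univ.filter (· ∈ s)).card := by
      simp [Set.indicator]
    rw [this, Fintype.card_fun, Fintype.card_fin, Fintype.card_units_int]
    push_cast
    rfl
  · intro x _ y _ hxy
    rw [Function.onFun, Set.disjoint_left]
    intro ω hx hy
    exact hxy (hx.symm.trans hy)
  · exact fun x _ => (measure_signs_eq hX n x).1

theorem ae_prod_eq_chi (hX : IsRademacherSequence P X) (n : ℕ) :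
    ∀ᵐ ω ∂P, ∀ A : Finset (Fin n), ∏ k ∈ natSet A, X k ω = chi A (signs X n ω) := by
  have : ∀ᵐ ω ∂P, ∀ k, X k ω ^ 2 = 1 := ae_all_iff.2 hX.ae_sq
  filter_upwards [this] with ω h A
  rw [natSet, Finset.prod_map, chi]
  refine Finset.prod_congr rfl fun k _ => ?_
  rcases mul_self_eq_one_iff.1 ((sq (X k ω)).symm.trans (h k)) with h1 | h1
  · simp [signs, sgn, h1]
  · simp [signs, sgn, h1]
    norm_num

/-- The partial sum of the series of `J_q(f)` over the first `n` variables. -/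
def partialIntegral (hX : IsRademacherSequence P X) {q : ℕ} (n : ℕ) (f : (Fin q → ℕ) → ℝ) :
    Lp ℝ 2 P :=
  ∑ A : Finset (Fin n), walshCoeff n f A • walsh hX (enum q (natSet A))

theorem partialIntegral_ae_eq (hX : IsRademacherSequence P X) {q : ℕ} (n : ℕ)
    (f : (Fin q → ℕ) → ℝ) :
    partialIntegral hX n f =ᵐ[P] fun ω => poly (walshCoeff n f) (signs X n ω) := by
  have hw : ∀ᵐ ω ∂P, ∀ A : Finset (Fin n), (walshCoeff n f A • walsh hX (enum q (natSet A)) :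
      Lp ℝ 2 P) ω = walshCoeff n f A * ∏ k, X (enum q (natSet A) k) ω := by
    refine ae_all_iff.2 fun A => ?_
    filter_upwards [Lp.coeFn_smul (walshCoeff n f A) (walsh hX (enum q (natSet A))),
      (hX.memLp_prod (enum q (natSet A))).coeFn_toLp] with ω h1 h2
    rw [h1, Pi.smul_apply, smul_eq_mul, walsh, h2]
  filter_upwards [hw, ae_prod_eq_chi hX n, Lp.coeFn_finsetSum Finset.univ
    fun A : Finset (Fin n) => walshCoeff n f A • walsh hX (enum q (natSet A))] with ω h1 h2 h3
  rw [partialIntegral, h3, Finset.sum_apply, poly]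
  refine Finset.sum_congr rfl fun A _ => ?_
  rw [h1]
  by_cases hA : (natSet A).card = q
  · rw [← h2, ← Finset.prod_image (s := Finset.univ) (g := enum q (natSet A))
      (f := fun k => X k ω) (enum_injective hA).injOn, image_enum hA]
  · rw [walshCoeff, setKernel_of_card_ne f hA]
    simp

theorem tendsto_partialIntegral (hX : IsRademacherSequence P X) {q : ℕ} {f : (Fin q → ℕ) → ℝ}
    (hf : IsKernel f) :
    Filter.Tendsto (fun n => partialIntegral hX n f) Filter.atTop
      (nhds (multipleIntegral hX f)) := by
  have h1 := (summable_multipleIntegral hX hf.summable_sq).hasSum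
  set e : {i : Fin q → ℕ // StrictMono i} → Finset ℕ := fun i => Finset.univ.image i.1 with he
  have hcard : ∀ i, (e i).card = q := fun i => by
    rw [he, Finset.card_image_of_injective _ i.2.injective, Finset.card_fin]
  have henum : ∀ i, enum q (e i) = i.1 := fun i => by
    rw [enum, dif_pos (hcard i)]
    exact (Finset.orderEmbOfFin_unique (hcard i)
      (fun k => Finset.mem_image_of_mem _ (Finset.mem_univ k)) i.2).symm
  have hinj : Function.Injective e := fun i j h => by
    rw [Subtype.ext_iff, ← henum i, h, henum j]
  have hterm : (fun i : {i : Fin q → ℕ // StrictMono i} => f i • walsh hX i.1) =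
      (fun A => setKernel f A • walsh hX (enum q A)) ∘ e := by
    funext i
    rw [Function.comp_apply, henum, hf.eq_setKernel]
  rw [hterm, hinj.hasSum_iff] at h1
  · have h2 := h1.const_smul (q ! : ℝ)
    have h3 : Filter.Tendsto (fun n => (Finset.range n).powerset) Filter.atTop Filter.atTop := by
      refine Filter.tendsto_atTop_finset_of_monotone (fun m n h => ?_) fun A => ?_
      · exact Finset.powerset_mono.2 (Finset.range_mono h)
      · obtain ⟨n, hn⟩ := A.exists_nat_subset_range
        exact ⟨n, Finset.mem_powerset.2 hn⟩
    have h4 := Filter.Tendsto.comp h2 h3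
    rw [← hterm] at h4
    refine h4.congr fun n => ?_
    have h5 : (Finset.range n).powerset =
        (Finset.univ : Finset (Finset (Fin n))).image natSet := by
      ext A
      simp only [Finset.mem_powerset, Finset.mem_image, Finset.mem_univ, true_and]
      constructor
      · intro h
        refine ⟨Finset.univ.filter fun k => (k : ℕ) ∈ A, ?_⟩
        ext m
        simp only [natSet, Finset.mem_map, Finset.mem_filter, Finset.mem_univ, true_and,
          Fin.valEmbedding_apply]
        exact ⟨fun ⟨a, ha, hm⟩ => hm ▸ ha, fun hm => ⟨⟨m, Finset.mem_range.1 (h hm)⟩, hm, rfl⟩⟩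
      · rintro ⟨B, rfl⟩ m hm
        obtain ⟨a, -, rfl⟩ := Finset.mem_map.1 hm
        exact Finset.mem_range.2 a.2
    rw [Function.comp_apply, h5, Finset.sum_image natSet_injective.injOn, partialIntegral]
    refine Finset.sum_congr rfl fun A _ => ?_
    rw [walshCoeff, mul_smul]
  · intro A hA
    rw [setKernel_of_card_ne, zero_smul]
    intro h
    refine hA ⟨⟨A.orderEmbOfFin h, (A.orderEmbOfFin h).strictMono⟩, ?_⟩
    have := image_enum h
    rwa [enum, dif_pos h] at this

end Transfer

section Limit

variable {Ω : Type*} [MeasurableSpace Ω] {P : Measure Ω} [IsProbabilityMeasure P]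

/-- A uniform bound on the distance to the normal distribution function is preserved by
convergence in measure. -/
theorem abs_measureReal_sub_le_of_tendstoInMeasure {Z : ℕ → Ω → ℝ} {Y : Ω → ℝ} {M : ℝ}
    (hZ : TendstoInMeasure P Z Filter.atTop Y)
    (hM : ∀ᶠ n in Filter.atTop, ∀ y, |P.real {ω | Z n ω ≤ y} - normalCDF y| ≤ M) (y : ℝ) :
    |P.real {ω | Y ω ≤ y} - normalCDF y| ≤ M := by
  rw [tendstoInMeasure_iff_measureReal_norm] at hZ
  refine le_of_forall_pos_le_add fun ε hε => ?_
  have h1 := hZ (ε / 2) (half_pos hε)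
  obtain ⟨n, hn1, hn2⟩ := (hM.and (h1.eventually_lt_const (half_pos hε))).exists
  have up : P.real {ω | Y ω ≤ y} ≤ P.real {ω | Z n ω ≤ y + ε / 2} +
      P.real {ω | ε / 2 ≤ ‖Z n ω - Y ω‖} := by
    refine (measureReal_mono fun ω hω => ?_).trans (measureReal_union_le _ _)
    simp only [Set.mem_ofPred_eq, Set.mem_union, Real.norm_eq_abs] at hω ⊢
    by_contra! h
    linarith [(abs_lt.1 h.2).2]
  have low : P.real {ω | Z n ω ≤ y - ε / 2} ≤ P.real {ω | Y ω ≤ y} +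
      P.real {ω | ε / 2 ≤ ‖Z n ω - Y ω‖} := by
    refine (measureReal_mono fun ω hω => ?_).trans (measureReal_union_le _ _)
    simp only [Set.mem_ofPred_eq, Set.mem_union, Real.norm_eq_abs] at hω ⊢
    by_contra! h
    linarith [(abs_lt.1 h.2).1]
  have c1 := abs_le.1 (hn1 (y + ε / 2))
  have c2 := abs_le.1 (hn1 (y - ε / 2))
  have c3 := normalCDF_add_le y (half_pos hε).le
  have c4 := normalCDF_add_le (y - ε / 2) (half_pos hε).le
  rw [sub_add_cancel] at c4
  rw [abs_le]
  constructor <;> linarith [c1.1, c1.2, c2.1, c2.2]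

theorem abs_measureReal_multipleIntegral_sub_le {X : ℕ → Ω → ℝ}
    (hX : IsRademacherSequence P X) {q : ℕ} (hq : 2 ≤ q) {f : (Fin q → ℕ) → ℝ} (hf : IsKernel f)
    {t : ℝ} (ht1 : t ≤ 1) (hB : firstBound hq f < t) (y : ℝ) :
    |P.real {ω | multipleIntegral hX f ω ≤ y} - normalCDF y| ≤ berryEsseenConst q * t := by
  have b1 : |1 - (q ! : ℝ) * l2norm f ^ 2| < t := (le_max_left _ _).trans_lt hB
  have b2 : ∀ r ∈ Finset.Icc 1 (q - 1), offDiagContrNorm r f < t := fun r hr =>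
    ((Finset.le_sup' (fun r => offDiagContrNorm r f) hr).trans
      ((le_max_left _ _).trans (le_max_right _ _))).trans_lt hB
  have b3 : contrNorm q (q - 1) f < t :=
    ((Finset.le_sup' (fun r => contrNorm r (r - 1) f)
      (Finset.mem_Icc.2 ⟨by omega, le_rfl⟩ : q ∈ Finset.Icc 1 q)).trans
      ((le_max_right _ _).trans (le_max_right _ _))).trans_lt hB
  have ht : 0 < t := (abs_nonneg _).trans_lt b1
  refine abs_measureReal_sub_le_of_tendstoInMeasure
    (tendstoInMeasure_of_tendsto_Lp (tendsto_partialIntegral hX hf)) ?_ y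
  have l1 : Filter.Tendsto (fun n => |1 - (q ! : ℝ) * l2norm (truncate n f) ^ 2|) Filter.atTop
      (nhds |1 - (q ! : ℝ) * l2norm f ^ 2|) :=
    ((((tendsto_l2norm_truncate hf.summable_sq).pow 2).const_mul _).const_sub 1).abs
  have e2 : ∀ᶠ n in Filter.atTop, ∀ r ∈ Finset.Icc 1 (q - 1),
      offDiagContrNorm r (truncate n f) < t :=
    (Filter.eventually_all_finset _).2 fun r hr =>
      (tendsto_offDiagContrNorm (by have := Finset.mem_Icc.1 hr; omega)
        hf.summable_sq).eventually_lt_const (b2 r hr)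
  have e3 := (tendsto_contrNorm (l := q - 1) (by omega) le_rfl
    hf.summable_sq).eventually_lt_const b3
  filter_upwards [l1.eventually_lt_const b1, e2, e3] with n h1 h2 h3 y
  have h := abs_avg_indicator_sub_le_of_finite (by omega) (hf.truncate n) (truncate_ne_zero n)
    ht ht1 h1.le (fun r hr => (h2 r hr).le) h3.le y
  rw [walshCoeff_truncate] at h
  have hP : P.real {ω | partialIntegral hX n f ω ≤ y} =
      avg fun x => (Set.Iic y).indicator 1 (poly (walshCoeff n f) x) := by
    have h4 : P.real {ω | partialIntegral hX n f ω ≤ y} =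
        P.real {ω | signs X n ω ∈ {x | poly (walshCoeff n f) x ≤ y}} := by
      refine measureReal_congr ?_
      filter_upwards [partialIntegral_ae_eq hX n f] with ω hω
      refine propext ?_
      change partialIntegral hX n f ω ≤ y ↔ poly (walshCoeff n f) (signs X n ω) ≤ y
      rw [hω]
    rw [h4, measureReal_signs hX]
    rfl
  rwa [hP]

end Limit

end Rademacher

open Rademacher in
theorem mainTheorem3 (q : ℕ) (hq : 2 ≤ q) :
    ∃ C₁ C₂ : ℝ, 0 < C₁ ∧ 0 < C₂ ∧
      ∀ (Ω : Type*) [MeasurableSpace Ω] (P : Measure Ω) [IsProbabilityMeasure P]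
        (X : ℕ → Ω → ℝ) (hX : Rademacher.IsRademacherSequence P X)
        (Ω' : Type*) [MeasurableSpace Ω'] (Q : Measure Ω') [IsProbabilityMeasure Q]
        (N : Ω' → ℝ) (_hN : HasLaw N (gaussianReal 0 1) Q)
        (f : (Fin q → ℕ) → ℝ) (_hf : Rademacher.IsKernel f)
        (_hsmall : ∀ r ∈ Finset.Icc 1 (q - 1), Rademacher.offDiagContrNorm r f < 1),
        Rademacher.kolmogorovDist P (Rademacher.multipleIntegral hX f) Q N
            ≤ C₁ * Rademacher.firstBound hq f ∧
          C₁ * Rademacher.firstBound hq f ≤ C₂ * Rademacher.secondBound hq f := by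
  have hC := one_le_berryEsseenConst q
  have hC0 : 0 < berryEsseenConst q := by linarith
  refine ⟨berryEsseenConst q, berryEsseenConst q, hC0, hC0, ?_⟩
  intro Ω _ P _ X hX Ω' _ Q _ N hN f hf _
  refine ⟨?_, mul_le_mul_of_nonneg_left (firstBound_le_secondBound hq hf) hC0.le⟩
  refine ciSup_le fun y => ?_
  have hQ : Q.real {ω | N ω ≤ y} = normalCDF y := by
    rw [normalCDF, ← hN.map_eq, measureReal_def, measureReal_def,
      Measure.map_apply_of_aemeasurable hN.aemeasurable measurableSet_Iic]
    rfl
  rw [hQ]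
  -- If the bound is at least `1` there is nothing to prove, as the distance is at most `1`.
  rcases lt_or_ge (firstBound hq f) 1 with hB | hB
  · refine ge_of_tendsto (x := nhdsWithin (firstBound hq f) (Set.Ioi (firstBound hq f)))
      (f := fun t => berryEsseenConst q * t)
      ((continuous_const.mul continuous_id).continuousWithinAt) ?_
    filter_upwards [Ioo_mem_nhdsGT hB] with t ht
    exact abs_measureReal_multipleIntegral_sub_le hX hq hf ht.2.le ht.1 y
  · have h1 : |P.real {ω | multipleIntegral hX f ω ≤ y} - normalCDF y| ≤ 1 := by
      have a1 : 0 ≤ P.real {ω | multipleIntegral hX f ω ≤ y} := measureReal_nonneg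
      have a2 : P.real {ω | multipleIntegral hX f ω ≤ y} ≤ 1 := measureReal_le_one
      have a3 := normalCDF_nonneg y
      have a4 := normalCDF_le_one y
      rw [abs_le]
      constructor <;> linarith
    refine h1.trans (hC.trans ?_)
    exact le_mul_of_one_le_right hC0.le hB
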